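/- **Theorem (Sample complexity of MMD-$k$, close-to-pure mixed states).** *Setting.* Let $|\psi_1\rangle,\dots,|\psi_N\rangle$ and $|\chi_1\rangle,\dots,|\chi_N\rangle$ ($N\ge 1$) be unit vectors of $\mathbb C^d$, and let $\mathcal E_1,\mathcal E_2$ be the corresponding uniform ensembles (each state has probability $1/N$). Both are sent through the depolarizing channel $E(\rho)=(1-\lambda_b)\rho+\lambda_b I/d$, $0\le\lambda_b\le 1$; write $E(\mathcal E_1),E(\mathcal E_2)$ for the output ensembles $\{(1/N,E(|\psi_i\rangle\langle\psi_i|))\}_i$, $\{(1/N,E(|\chi_j\rangle\langle\chi_j|))\}_j$, and put $\epsilon_b=(1-1/d)\lambda_b$. For an integer $k\ge 1$ and ensembles $\mathcal A,\mathcal B$, $$\mathcal D^{(k)}(\mathcal A,\mathcal B)=\bar F^{(k)}(\mathcal A,\mathcal A)+\bar F^{(k)}(\mathcal B,\mathcal B)-2\bar F^{(k)}(\mathcal A,\mathcal B),\qquad \bar F^{(k)}(\mathcal A,\mathcal B)=\mathbb E\big[\operatorname{Tr}(\rho\sigma)^k\big],$$ with $\rho\sim\mathcal A$, $\sigma\sim\mathcal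 B$ independent (so $\operatorname{Tr}(\rho\sigma)=|\langle v|w\rangle|^2$ for pure states). *Samples and estimator.* One sample for a pair of ensembles consists of a label $\ell=(i,j)$, where $i$ and $j$ are drawn independently from the two ensembles, and the value $R=+1$ or $R=-1$ according to whether the SWAP test on the two states returns ancilla $0$ or $1$. All samples are independent. Given $M$ samples in total, $\lfloor M/3\rfloor$ are used for each of the pairs $(1,1)$, $(2,2)$, $(1,2)$ of output ensembles. For each pair, let $T_\ell$ be the number of samples with label $\ell$; for $T_\ell\ge k$ let $Z_\ell=\binom{T_\ell}{k}^{-1}\sum R_{t_1}\cdots R_{t_k}$, the sum being over all $k$-element sets $\{t_1,\dots,t_k\}$ of samples with label $\ell$; estimate $\bar F^{(k)}$ by the average of $Z_\ell$ over the labels with $T_\ell\ge k$ (by $0$ if there are none). Combining the three estimates as in $\mathcal D^{(k)}$ gives $\widehat{\mathcal D}^{(k)}$. *Claim.* For every $\delta_0<1$ there is a constant $C>0$, depending only on $\delta_0$, such that for all $k\ge1$, $N$, $d$, all $\mathcal E_1,\mathcal E_2$ and $\lambda_b$ as above, all $\delta\in(0,\delta_0]$ and all $\epsilon$ with $$\epsilon>32k\sqrt{(1-1/d)\lambda_b},\qquad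 N^2\ \ge\ \frac{k!}{\big(\epsilon-32k\sqrt{(1-1/d)\lambda_b}\big)^2}\log\frac1\delta ,$$ there is an integer $$M_0\ \le\ C\left(\frac{k!}{\big(\epsilon-32k\sqrt{(1-1/d)\lambda_b}\big)^2}\log\frac1\delta\right)^{1/k}N^{2-2/k}$$ such that for every $M\ge M_0$ the estimator $\widehat{\mathcal D}^{(k)}$ with $M$ samples satisfies: 1. $\Pr\big[\,|\widehat{\mathcal D}^{(k)}-\mathcal D^{(k)}(E(\mathcal E_1),E(\mathcal E_2))|\le\epsilon\,\big]\ge 1-\delta$; 2. the same bound holds when the target is the MMD-$k$ of pure-state ensembles that represent the outputs by $\epsilon$-balls: let $\mu_i$ (resp. $\nu_j$) be any probability laws on unit vectors $v$ supported in the ball $1-|\langle v|\psi_i\rangle|^2\le\epsilon_b$ (resp. $1-|\langle v|\chi_j\rangle|^2\le\epsilon_b$) with average $\int|v\rangle\langle v|\,d\mu_i=E(|\psi_i\rangle\langle\psi_i|)$ (resp. $\int|v\rangle\langle v|\,d\nu_j=E(|\chi_j\rangle\langle\chi_j|)$); then $\Pr\big[\,|\widehat{\mathcal D}^{(k)}-\mathcal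 D^{(k)}(\tfrac1N\sum_i\mu_i,\tfrac1N\sum_j\nu_j)|\le\epsilon\,\big]\ge1-\delta$. -/

import Mathlib

open MeasureTheory
open scoped Matrix Kronecker ComplexOrder Nat

noncomputable section

namespace QEns

/-! ### States, fidelity, balls and the depolarizing channel -/

/-- Density operators on `ℂ^d`: positive semidefinite matrices of trace one. -/
structure DensityOperator (d : ℕ) where
  mat : Matrix (Fin d) (Fin d) ℂ
  posSemidef : mat.PosSemidef
  trace_eq_one : mat.trace = 1

/-- Pure states (unit vectors) of `ℂ^d`. -/
abbrev PureState (d : ℕ) : Type :=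
  {v : EuclideanSpace ℂ (Fin d) // ‖v‖ = 1}

/-- The projector `|v⟩⟨v|`. -/
def PureState.toDensity {d : ℕ} (v : PureState d) : DensityOperator d where
  mat := Matrix.vecMulVec (fun a => v.1 a) (star fun a => v.1 a)
  posSemidef := Matrix.posSemidef_vecMulVec_self_star _
  trace_eq_one := by
    have h : ∑ a, ‖v.1 a‖ ^ 2 = 1 := by
      rw [← EuclideanSpace.norm_sq_eq, v.2, one_pow]
    simp only [Matrix.trace, Matrix.diag_apply, Matrix.vecMulVec_apply, Pi.star_apply]
    have h2 : ∀ a, v.1 a * star (v.1 a) = ((‖v.1 a‖ ^ 2 : ℝ) : ℂ) := by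
      intro a
      rw [Complex.star_def, Complex.mul_conj, Complex.normSq_eq_norm_sq]
    simp only [h2]
    rw [← Complex.ofReal_sum, h, Complex.ofReal_one]

/-- The fidelity `|⟨v|w⟩|²` of two pure states. -/
def fidelity {d : ℕ} (v w : PureState d) : ℝ := ‖inner ℂ v.1 w.1‖ ^ 2

/-- The `ε`-ball of radius `r` around the central state `c`. -/
def epsBall {d : ℕ} (c : PureState d) (r : ℝ) : Set (PureState d) :=
  {v | 1 - fidelity v c ≤ r}

/-- The depolarizing channel `ρ ↦ (1 - lam) ρ + lam I / d`. -/
def depolarize {d : ℕ} (lam : ℝ) (h0 : 0 ≤ lam) (h1 : lam ≤ 1) (ρ : DensityOperator d) :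
    DensityOperator d where
  mat := ((1 - lam : ℝ) : ℂ) • ρ.mat + ((lam / d : ℝ) : ℂ) • (1 : Matrix (Fin d) (Fin d) ℂ)
  posSemidef := by
    refine Matrix.PosSemidef.add (ρ.posSemidef.smul ?_) (Matrix.PosSemidef.one.smul ?_)
    · exact Complex.zero_le_real.mpr (by linarith)
    · exact Complex.zero_le_real.mpr (by positivity)
  trace_eq_one := by
    have hd : (d : ℂ) ≠ 0 := by
      rcases Nat.eq_zero_or_pos d with h | h
      · subst h
        have := ρ.trace_eq_one
        simp [Matrix.trace] at this
      · exact_mod_cast h.ne'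
    rw [Matrix.trace_add, Matrix.trace_smul, Matrix.trace_smul, ρ.trace_eq_one, Matrix.trace_one]
    simp only [smul_eq_mul, Fintype.card_fin]
    push_cast
    field_simp
    ring

/-! ### Ensembles and MMD-`k` -/

/-- An ensemble of `N` (possibly mixed) states with its probabilities. -/
structure Ensemble (N d : ℕ) where
  prob : Fin N → ℝ
  prob_nonneg : ∀ x, 0 ≤ prob x
  sum_prob : ∑ x, prob x = 1
  state : Fin N → DensityOperator d

/-- The uniform ensemble of the `N` pure states `ψ 0, …, ψ (N - 1)`. -/
def uniformPure {N d : ℕ} [NeZero N] (ψ : Fin N → PureState d) : Ensemble N d where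
  prob := fun _ => 1 / N
  prob_nonneg := fun _ => by positivity
  sum_prob := by simp
  state := fun x => (ψ x).toDensity

/-- The ensemble obtained by sending every state through the depolarizing channel. -/
def Ensemble.depolarized {N d : ℕ} (E : Ensemble N d) (lam : ℝ) (h0 : 0 ≤ lam) (h1 : lam ≤ 1) :
    Ensemble N d where
  prob := E.prob
  prob_nonneg := E.prob_nonneg
  sum_prob := E.sum_prob
  state := fun x => depolarize lam h0 h1 (E.state x)

/-- The overlap `Tr(ρ σ)`; it is `|⟨v|w⟩|²` for `ρ = |v⟩⟨v|` and `σ = |w⟩⟨w|`. -/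
def overlap {d : ℕ} (ρ σ : DensityOperator d) : ℝ := ((ρ.mat * σ.mat).trace).re

/-- `F^(k)(E, E')`, the expectation of `Tr(ρ σ)^k` for independent `ρ ∼ E`, `σ ∼ E'`. -/
def meanOverlap {N d : ℕ} (k : ℕ) (E E' : Ensemble N d) : ℝ :=
  ∑ i, ∑ j, E.prob i * E'.prob j * overlap (E.state i) (E'.state j) ^ k

/-- MMD-`k`. As `Tr(ρ σ)^k = Tr(ρ^{⊗k} σ^{⊗k})`, this is `Tr[(𝔼 ρ^{⊗k} - 𝔼 σ^{⊗k})²]`, the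
squared Hilbert-Schmidt distance of the `k`-th moment operators. -/
def mmd {N d : ℕ} (k : ℕ) (E E' : Ensemble N d) : ℝ :=
  meanOverlap k E E + meanOverlap k E' E' - 2 * meanOverlap k E E'

/-- `F^(k)` for (possibly infinite) ensembles of pure states, given by their laws: the
expectation of `|⟨v|w⟩|^{2k}` for independent `v ∼ μ`, `w ∼ ν`. -/
def pureMeanFidelity {d : ℕ} (k : ℕ) (μ ν : Measure (PureState d)) : ℝ :=
  ∫ v, ∫ w, fidelity v w ^ k ∂ν ∂μ

/-- MMD-`k` for (possibly infinite) ensembles of pure states, given by their laws. -/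
def pureMMD {d : ℕ} (k : ℕ) (μ ν : Measure (PureState d)) : ℝ :=
  pureMeanFidelity k μ μ + pureMeanFidelity k ν ν - 2 * pureMeanFidelity k μ ν

/-- `ν` is a probability law of pure states in the `ε`-ball of radius `r` around `c`, whose average
`∫ |v⟩⟨v| dν(v)` is the density operator `ρ`. -/
def IsBallRepresentation {d : ℕ} (c : PureState d) (r : ℝ) (ρ : DensityOperator d)
    (ν : Measure (PureState d)) : Prop :=
  IsProbabilityMeasure ν ∧ (∀ᵐ v ∂ν, v ∈ epsBall c r) ∧
    ∀ a b, ∫ v, v.toDensity.mat a b ∂ν = ρ.mat a b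

/-- The law of a state drawn from one of the `N` balls, chosen uniformly. -/
def uniformMixture {N d : ℕ} (ν : Fin N → Measure (PureState d)) : Measure (PureState d) :=
  (N : ENNReal)⁻¹ • ∑ x, ν x

/-! ### The SWAP test -/

/-- The Hadamard gate. -/
def hadamard : Matrix (Fin 2) (Fin 2) ℂ := ((1 / Real.sqrt 2 : ℝ) : ℂ) • !![1, 1; 1, -1]

/-- The controlled SWAP gate on (ancilla, first register, second register). -/
def controlledSwap (d : ℕ) : Matrix (Fin 2 × Fin d × Fin d) (Fin 2 × Fin d × Fin d) ℂ :=
  Matrix.of fun x y => if x = (y.1, if y.1 = 1 then y.2.swap else y.2) then 1 else 0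

/-- The unitary of the SWAP test: Hadamard on the ancilla, controlled SWAP, Hadamard on the
ancilla. -/
def swapCircuit (d : ℕ) : Matrix (Fin 2 × Fin d × Fin d) (Fin 2 × Fin d × Fin d) ℂ :=
  (hadamard ⊗ₖ (1 : Matrix (Fin d × Fin d) (Fin d × Fin d) ℂ)) * controlledSwap d *
    (hadamard ⊗ₖ (1 : Matrix (Fin d × Fin d) (Fin d × Fin d) ℂ))

/-- The Born probability that the ancilla, started in `|0⟩`, is found in `|b⟩` at the end of the
SWAP test on `ρ ⊗ σ`. -/
def swapProb {d : ℕ} (ρ σ : DensityOperator d) (b : Fin 2) : ℝ :=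
  (((Matrix.single b b (1 : ℂ)) ⊗ₖ (1 : Matrix (Fin d × Fin d) (Fin d × Fin d) ℂ) *
    (swapCircuit d * ((Matrix.single 0 0 (1 : ℂ)) ⊗ₖ (ρ.mat ⊗ₖ σ.mat)) *
      (swapCircuit d)ᴴ)).trace).re

/-! ### Samples and the U-statistic estimator -/

/-- One sample: the label `ℓ = (i, j)` and the measured bit of the ancilla. -/
abbrev Sample (N : ℕ) : Type := (Fin N × Fin N) × Fin 2

/-- The law of one sample: draw `i` from `E` and `j` from `E'` independently, and apply the SWAP
test to the two states. -/
def sampleLaw {N d : ℕ} (E E' : Ensemble N d) : Measure (Sample N) :=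
  ∑ i, ∑ j, ∑ b,
    ENNReal.ofReal (E.prob i * E'.prob j * swapProb (E.state i) (E'.state j) b) •
      Measure.dirac ((i, j), b)

/-- The value `R`: `+1` for the outcome `0`, and `-1` for the outcome `1`. -/
def rValue (b : Fin 2) : ℝ := if b = 0 then 1 else -1

/-- The set of (indices of) samples with label `ℓ`. Its cardinality is `T_ℓ`. -/
def samplesAt {N n : ℕ} (x : Fin n → Sample N) (ℓ : Fin N × Fin N) : Finset (Fin n) :=
  Finset.univ.filter fun t => (x t).1 = ℓ

/-- The U-statistic `Z_ℓ` of order `k` of the values with label `ℓ`. -/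
def uStat {N n : ℕ} (k : ℕ) (x : Fin n → Sample N) (ℓ : Fin N × Fin N) : ℝ :=
  (1 / ((samplesAt x ℓ).card.choose k : ℝ)) *
    ∑ s ∈ (samplesAt x ℓ).powersetCard k, ∏ t ∈ s, rValue (x t).2

/-- The labels with at least `k` samples. -/
def goodLabels {N n : ℕ} (k : ℕ) (x : Fin n → Sample N) : Finset (Fin N × Fin N) :=
  Finset.univ.filter fun ℓ => k ≤ (samplesAt x ℓ).card

/-- The estimator of `F^(k)`: the average of `Z_ℓ` over the labels with at least `k` samples
(and `0` if there is no such label). -/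
def fHat {N n : ℕ} (k : ℕ) (x : Fin n → Sample N) : ℝ :=
  (1 / ((goodLabels k x).card : ℝ)) * ∑ ℓ ∈ goodLabels k x, uStat k x ℓ

/-- Three data sets of `n` samples each, for the pairs `(1,1)`, `(2,2)`, `(1,2)`. -/
abbrev Data (N n : ℕ) : Type :=
  (Fin n → Sample N) × (Fin n → Sample N) × (Fin n → Sample N)

/-- The joint law of the data; all samples are independent. -/
def dataLaw {N d : ℕ} (n : ℕ) (E₁ E₂ : Ensemble N d) : Measure (Data N n) :=
  (Measure.pi fun _ => sampleLaw E₁ E₁).prod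
    ((Measure.pi fun _ => sampleLaw E₂ E₂).prod (Measure.pi fun _ => sampleLaw E₁ E₂))

/-- The U-statistic estimator of MMD-`k`. -/
def mmdHat {N n : ℕ} (k : ℕ) (x : Data N n) : ℝ :=
  fHat k x.1 + fHat k x.2.1 - 2 * fHat k x.2.2

/-- The estimator, used with `M` samples in total (`⌊M/3⌋` for each of the three pairs) from `E₁`
and `E₂`, is within `ε` of the number `D` except with probability at most `δ`. -/
def EstimatesWith {N d : ℕ} (k M : ℕ) (E₁ E₂ : Ensemble N d) (D ε δ : ℝ) : Prop :=
  1 - δ ≤ (dataLaw (M / 3) E₁ E₂).real {x | |mmdHat k x - D| ≤ ε}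

/-- The radius `(1 - 1/d) lam` of the ball that represents an output of the depolarizing
channel. -/
def ballRadius (d : ℕ) (lam : ℝ) : ℝ := (1 - 1 / (d : ℝ)) * lam

end QEns

end

noncomputable section

namespace QEns

/-! ### Exponential inequalities -/

/-! The SWAP test gives `R` the mean `Tr(ρσ)` (`swapProb_eq`), so, given the labels, each `Z_ℓ` is
an unbiased estimate of `μ_ℓ ^ k`, where `μ_ℓ` is the overlap at label `ℓ`. Write `8t = ε -
32k√ε_b`. It suffices to estimate each of the three means within `2t` with failure probability at
most `δ/3`: the errors add up to `2t + 2t + 2·2t = 8t`. Passing to pure states in the balls moves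
MMD-`k` by at most `32k√ε_b` (`abs_mmd_sub_pureMMD_le`), which is the remaining part of `ε`.

For one pair there are `Q = N²` labels and `n` samples. The error of the averaged `Z_ℓ` has two
parts. The selection bias is the deviation of the average of `μ_ℓ ^ k` over the labels with at least
`k` samples from the average over all labels. It is controlled by exponential moments, since
multinomial counts are negatively associated (`weightedMean_prod_le`,
`weightedMean_exp_centred_le`). The fluctuation of the `Z_ℓ` is, given the labels, a sum of
independent bounded terms with variance at most `min(1, k²/T_ℓ)`, to which a Bernstein-type bound
applies (`weightedProb_abs_sum_uMean_sub_le`).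

With `L = log(1/δ)`, let `a` solve `a^k Q (8t)² = k! L`; the claimed sample size is of order `aQ`.
There are two regimes. If `a^k` is small against `k!`, a label has at least `k` samples with
probability `p` at least a large constant times `a^k/k!`. About `pQ` labels then contribute, and
`pQt²` is a large multiple of `L`, so variance `1` suffices
(`weightedProb_meanUMean_le_of_frequent`). Otherwise `p ≤ 1` prevents `pQt²` from being that large.
But then `k` is bounded, `a` is bounded below, and a large `C` forces `n/Q` to be large: almost
every label has at least `kr` samples, which makes both the variances and the bias small
(`weightedProb_meanUMean_le_of_rare`). `exists_sample_complexity` fixes the constants and joins the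
two regimes. -/

lemma exp_le_one_add_add_sq (y : ℝ) : Real.exp y ≤ 1 + y + y ^ 2 * Real.exp |y| := by
  have h1 : Real.exp y - 1 ≤ y * Real.exp y := by
    have := Real.add_one_le_exp (-y)
    have h2 : Real.exp y * Real.exp (-y) = 1 := by rw [← Real.exp_add]; simp
    nlinarith [Real.exp_pos y]
  have h0 := Real.add_one_le_exp y
  rcases le_total 0 y with hy | hy
  · rw [abs_of_nonneg hy]
    nlinarith [mul_le_mul_of_nonneg_left h1 hy]
  · have h3 : 1 ≤ Real.exp |y| := Real.one_le_exp (abs_nonneg y)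
    have h4 : y * (Real.exp y - 1) ≤ y ^ 2 := by nlinarith
    nlinarith [sq_nonneg y, mul_le_mul_of_nonneg_left h3 (sq_nonneg y)]

/-- The source of every Bernstein-type bound below: for centred bounded `y` the linear term vanishes
in the mean, leaving only the variance. -/
lemma exp_mul_le_of_abs_le {s y c : ℝ} (hy : |y| ≤ c) :
    Real.exp (s * y) ≤ 1 + s * y + s ^ 2 * Real.exp (c * |s|) * y ^ 2 := by
  have h := exp_le_one_add_add_sq (s * y)
  have h2 : Real.exp |s * y| ≤ Real.exp (c * |s|) := by
    rw [abs_mul, mul_comm c]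
    exact Real.exp_le_exp.mpr (mul_le_mul_of_nonneg_left hy (abs_nonneg s))
  have h3 := mul_le_mul_of_nonneg_left h2 (sq_nonneg (s * y))
  nlinarith

/-! ### Means of functions of independent coordinates -/

lemma dependsOn_prod {ι α κ : Type*} {S : κ → Set ι} {f : κ → (ι → α) → ℝ}
    (hf : ∀ j, DependsOn (f j) (S j)) (s : Finset κ) :
    DependsOn (fun x => ∏ j ∈ s, f j x) (⋃ j ∈ s, S j) := by
  intro x y h
  refine Finset.prod_congr rfl fun j hj => hf j fun i hi => h i ?_
  simp only [Set.mem_iUnion]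
  exact ⟨j, hj, hi⟩

section WeightedMean

variable {ι α : Type*} [Fintype ι] [DecidableEq ι] [Fintype α]

/-- The mean of `f` when the coordinates are independent and the `i`-th one has weights `w i`. -/
def weightedMean (w : ι → α → ℝ) (f : (ι → α) → ℝ) : ℝ :=
  ∑ x, (∏ i, w i (x i)) * f x

variable {w : ι → α → ℝ}

lemma weightedMean_mono (hw : ∀ i a, 0 ≤ w i a) {f g : (ι → α) → ℝ} (h : ∀ x, f x ≤ g x) :
    weightedMean w f ≤ weightedMean w g :=
  Finset.sum_le_sum fun x _ =>
    mul_le_mul_of_nonneg_left (h x) (Finset.prod_nonneg fun i _ => hw i _)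

lemma weightedMean_nonneg (hw : ∀ i a, 0 ≤ w i a) {f : (ι → α) → ℝ} (h : ∀ x, 0 ≤ f x) :
    0 ≤ weightedMean w f :=
  Finset.sum_nonneg fun x _ => mul_nonneg (Finset.prod_nonneg fun i _ => hw i _) (h x)

lemma weightedMean_add (f g : (ι → α) → ℝ) :
    weightedMean w (fun x => f x + g x) = weightedMean w f + weightedMean w g := by
  simp [weightedMean, mul_add, Finset.sum_add_distrib]

lemma weightedMean_sub (f g : (ι → α) → ℝ) :
    weightedMean w (fun x => f x - g x) = weightedMean w f - weightedMean w g := by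
  simp [weightedMean, mul_sub, Finset.sum_sub_distrib]

lemma weightedMean_const_mul (c : ℝ) (f : (ι → α) → ℝ) :
    weightedMean w (fun x => c * f x) = c * weightedMean w f := by
  simp only [weightedMean, Finset.mul_sum]
  exact Finset.sum_congr rfl fun x _ => by ring

lemma weightedMean_sum {κ : Type*} (s : Finset κ) (f : κ → (ι → α) → ℝ) :
    weightedMean w (fun x => ∑ j ∈ s, f j x) = ∑ j ∈ s, weightedMean w (f j) := by
  simp only [weightedMean, Finset.mul_sum]
  exact Finset.sum_comm

lemma weightedMean_prod (h : ι → α → ℝ) :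
    weightedMean w (fun x => ∏ i, h i (x i)) = ∏ i, ∑ a, w i a * h i a := by
  rw [Finset.prod_univ_sum]
  simp [weightedMean, Finset.prod_mul_distrib]

lemma weightedMean_const (hw1 : ∀ i, ∑ a, w i a = 1) (c : ℝ) :
    weightedMean w (fun _ => c) = c := by
  classical
  have h := weightedMean_prod (w := w) (fun _ _ => 1)
  simp only [Finset.prod_const_one, mul_one, hw1] at h
  have h2 := weightedMean_const_mul (w := w) c (fun _ => 1)
  rw [h] at h2
  simpa using h2

/-- Functions of disjoint sets of coordinates are uncorrelated. -/
lemma weightedMean_mul_of_dependsOn (hw1 : ∀ i, ∑ a, w i a = 1)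
    {f g : (ι → α) → ℝ} {S T : Set ι} (hf : DependsOn f S) (hg : DependsOn g T)
    (hST : Disjoint S T) :
    weightedMean w (fun x => f x * g x) = weightedMean w f * weightedMean w g := by
  classical
  -- Take two independent copies and exchange their coordinates off `S`. This preserves the product
  -- weight and turns `f x * g y` into `f x * g x`, since `T` lies off `S`.
  let e : (ι → α) × (ι → α) → (ι → α) × (ι → α) := fun z => (S.piecewise z.1 z.2, S.piecewise z.2 z.1)
  have he : Function.Involutive e := by
    rintro ⟨x, y⟩
    simp only [e, Prod.mk.injEq]
    constructor <;> funext i <;> by_cases hi : i ∈ S <;> simp [hi]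
  have h1 : weightedMean w f * weightedMean w g
      = ∑ z : (ι → α) × (ι → α), ((∏ i, w i (z.1 i)) * (∏ i, w i (z.2 i))) * (f z.1 * g z.2) := by
    rw [weightedMean, weightedMean, Finset.sum_mul_sum, Fintype.sum_prod_type]
    exact Finset.sum_congr rfl fun x _ => Finset.sum_congr rfl fun y _ => by ring
  have h2 : weightedMean w (fun x => f x * g x)
      = ∑ z : (ι → α) × (ι → α), ((∏ i, w i (z.1 i)) * (∏ i, w i (z.2 i))) * (f z.1 * g z.1) := by
    have hc := weightedMean_const hw1 1
    simp only [weightedMean, mul_one] at hc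
    rw [Fintype.sum_prod_type]
    simp only [weightedMean]
    refine Finset.sum_congr rfl fun x _ => ?_
    rw [← Finset.sum_mul, ← Finset.mul_sum, hc, mul_one]
  rw [h1, h2]
  refine Eq.trans ?_ (Equiv.sum_comp (Function.Involutive.toPerm e he) _)
  refine Finset.sum_congr rfl fun z _ => ?_
  obtain ⟨x, y⟩ := z
  simp only [Function.Involutive.coe_toPerm, e]
  rw [← Finset.prod_mul_distrib, ← Finset.prod_mul_distrib]
  congr 1
  · refine Finset.prod_congr rfl fun i _ => ?_
    by_cases hi : i ∈ S <;> simp [hi, mul_comm]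
  · congr 1
    · exact hf fun i hi => by simp [hi]
    · exact hg fun i hi => by simp [Set.disjoint_right.mp hST hi]

lemma weightedMean_prod_of_dependsOn {κ : Type*} (hw1 : ∀ i, ∑ a, w i a = 1)
    {S : κ → Set ι} {f : κ → (ι → α) → ℝ} (hf : ∀ j, DependsOn (f j) (S j))
    (hS : Pairwise (Function.onFun Disjoint S)) (s : Finset κ) :
    weightedMean w (fun x => ∏ j ∈ s, f j x) = ∏ j ∈ s, weightedMean w (f j) := by
  classical
  induction s using Finset.induction_on with
  | empty => simpa using weightedMean_const hw1 1
  | insert j s hj ih =>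
    simp only [Finset.prod_insert hj]
    rw [weightedMean_mul_of_dependsOn hw1 (hf j) (dependsOn_prod hf s), ih]
    simp only [Set.disjoint_iUnion_right]
    exact fun i hi => hS (by rintro rfl; exact hj hi)

open Classical in
/-- The probability of `A` when the coordinates are independent with weights `w`. -/
def weightedProb (w : ι → α → ℝ) (A : (ι → α) → Prop) : ℝ :=
  weightedMean w fun x => if A x then 1 else 0

lemma weightedProb_mono (hw : ∀ i a, 0 ≤ w i a) {A B : (ι → α) → Prop} (h : ∀ x, A x → B x) :
    weightedProb w A ≤ weightedProb w B := by
  classical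
  refine weightedMean_mono hw fun x => ?_
  by_cases hA : A x
  · simp [hA, h x hA]
  · simp only [hA, if_false]; split_ifs <;> norm_num

lemma weightedProb_or_le (hw : ∀ i a, 0 ≤ w i a) (A B : (ι → α) → Prop) :
    weightedProb w (fun x => A x ∨ B x) ≤ weightedProb w A + weightedProb w B := by
  classical
  rw [weightedProb, weightedProb, weightedProb, ← weightedMean_add]
  refine weightedMean_mono hw fun x => ?_
  by_cases hA : A x <;> by_cases hB : B x <;> simp [hA, hB]

lemma weightedProb_le_of_le_exp (hw : ∀ i a, 0 ≤ w i a) {A : (ι → α) → Prop}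
    {f : (ι → α) → ℝ} {u : ℝ} (h : ∀ x, A x → u ≤ f x) :
    weightedProb w A ≤ Real.exp (-u) * weightedMean w (fun x => Real.exp (f x)) := by
  classical
  rw [weightedProb, ← weightedMean_const_mul]
  refine weightedMean_mono hw fun x => ?_
  rw [← Real.exp_add]
  split_ifs with hA
  · exact Real.one_le_exp (by linarith [h x hA])
  · positivity

lemma weightedProb_abs_le (hw : ∀ i a, 0 ≤ w i a) {A : (ι → α) → Prop}
    {f : (ι → α) → ℝ} {s u B : ℝ} (hs : 0 ≤ s) (h : ∀ x, A x → u ≤ |f x|)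
    (hp : weightedMean w (fun x => Real.exp (s * f x)) ≤ B)
    (hm : weightedMean w (fun x => Real.exp (-s * f x)) ≤ B) :
    weightedProb w A ≤ 2 * (Real.exp (-(s * u)) * B) := by
  have h1 : weightedProb w A ≤ weightedProb w (fun x => s * u ≤ s * f x ∨ s * u ≤ -s * f x) := by
    refine weightedProb_mono hw fun x hx => ?_
    rcases abs_cases (f x) with ⟨h2, _⟩ | ⟨h2, _⟩
    · exact Or.inl (mul_le_mul_of_nonneg_left (h2 ▸ h x hx) hs)
    · right; have := mul_le_mul_of_nonneg_left (h2 ▸ h x hx) hs; linarith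
  have h2 := weightedProb_or_le hw (fun x => s * u ≤ s * f x) (fun x => s * u ≤ -s * f x)
  have h3 := weightedProb_le_of_le_exp hw (A := fun x => s * u ≤ s * f x)
    (f := fun x => s * f x) (u := s * u) fun x hx => hx
  have h4 := weightedProb_le_of_le_exp hw (A := fun x => s * u ≤ -s * f x)
    (f := fun x => -s * f x) (u := s * u) fun x hx => hx
  have h5 := mul_le_mul_of_nonneg_left hp (Real.exp_pos (-(s * u))).le
  have h6 := mul_le_mul_of_nonneg_left hm (Real.exp_pos (-(s * u))).le
  linarith

lemma weightedProb_le_one (hw : ∀ i a, 0 ≤ w i a) (hw1 : ∀ i, ∑ a, w i a = 1)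
    (A : (ι → α) → Prop) : weightedProb w A ≤ 1 := by
  classical
  calc weightedProb w A ≤ weightedMean w (fun _ => 1) :=
        weightedMean_mono hw fun x => by split_ifs <;> norm_num
    _ = 1 := weightedMean_const hw1 1

lemma weightedProb_nonneg (hw : ∀ i a, 0 ≤ w i a) (A : (ι → α) → Prop) :
    0 ≤ weightedProb w A := by
  classical
  exact weightedMean_nonneg hw fun x => by split_ifs <;> norm_num

lemma weightedMean_mul_sq_le (hw : ∀ i a, 0 ≤ w i a) (f g : (ι → α) → ℝ) :
    weightedMean w (fun x => f x * g x) ^ 2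
      ≤ weightedMean w (fun x => f x ^ 2) * weightedMean w (fun x => g x ^ 2) := by
  simp only [weightedMean]
  refine Finset.sum_sq_le_sum_mul_sum_of_sq_le_mul _
    (fun x _ => mul_nonneg (Finset.prod_nonneg fun i _ => hw i _) (sq_nonneg _))
    (fun x _ => mul_nonneg (Finset.prod_nonneg fun i _ => hw i _) (sq_nonneg _))
    fun x _ => le_of_eq (by ring)

end WeightedMean

/-! ### Label counts and their negative association -/

section LabelCount

variable {Λ : Type*} [Fintype Λ] [DecidableEq Λ] {n : ℕ}

/-- The number of samples with label `ℓ`. -/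
def labelCount (L : Fin n → Λ) (ℓ : Λ) : ℕ := (Finset.univ.filter fun t => L t = ℓ).card

lemma labelCount_cons (a : Λ) (L : Fin n → Λ) :
    labelCount (Fin.cons a L : Fin (n + 1) → Λ) = labelCount L + Pi.single a 1 := by
  funext ℓ
  simp only [labelCount, Finset.card_filter, Fin.sum_univ_succ, Fin.cons_zero, Fin.cons_succ,
    Pi.add_apply]
  rw [add_comm]
  congr 1
  by_cases h : a = ℓ
  · subst h; simp
  · simp [h, Ne.symm h]

lemma weightedMean_succ (u : Λ → ℝ) (f : (Fin (n + 1) → Λ) → ℝ) :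
    weightedMean (fun _ => u) f
      = ∑ a, u a * weightedMean (fun _ : Fin n => u) (fun L => f (Fin.cons a L)) := by
  simp only [weightedMean]
  rw [← (Fin.consEquiv fun _ => Λ).sum_comp, Fintype.sum_prod_type]
  refine Finset.sum_congr rfl fun a _ => ?_
  rw [Finset.mul_sum]
  refine Finset.sum_congr rfl fun L _ => ?_
  change (∏ i, u ((Fin.cons a L : Fin (n + 1) → Λ) i)) * f (Fin.cons a L) = _
  rw [Fin.prod_univ_succ, Fin.cons_zero]
  simp only [Fin.cons_succ]
  ring

/-- Monotone functions of the counts of disjoint sets of labels are negatively correlated. -/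
lemma weightedMean_mul_le_of_monotone {u : Λ → ℝ} (hu : ∀ a, 0 ≤ u a) (hu1 : ∑ a, u a = 1)
    {A B : Set Λ} (hAB : Disjoint A B) {f g : (Λ → ℕ) → ℝ} (hf : Monotone f) (hg : Monotone g)
    (hfA : DependsOn f A) (hgB : DependsOn g B) :
    weightedMean (fun _ : Fin n => u) (fun L => f (labelCount L) * g (labelCount L))
      ≤ weightedMean (fun _ : Fin n => u) (fun L => f (labelCount L)) *
        weightedMean (fun _ : Fin n => u) (fun L => g (labelCount L)) := by
  induction n generalizing f g with
  | zero => simp [weightedMean]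
  | succ n ih =>
    simp only [weightedMean_succ, labelCount_cons]
    set F : Λ → ℝ := fun a =>
      weightedMean (fun _ : Fin n => u) (fun L => f (labelCount L + Pi.single a 1)) with hF
    set G : Λ → ℝ := fun a =>
      weightedMean (fun _ : Fin n => u) (fun L => g (labelCount L + Pi.single a 1)) with hG
    set F0 := weightedMean (fun _ : Fin n => u) (fun L => f (labelCount L)) with hF0
    set G0 := weightedMean (fun _ : Fin n => u) (fun L => g (labelCount L)) with hG0
    have hshift : ∀ a, Monotone fun T : Λ → ℕ => T + Pi.single a 1 := fun a S T h =>
      add_le_add_left h _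
    have hdep : ∀ {h : (Λ → ℕ) → ℝ} {D : Set Λ} (a : Λ), DependsOn h D →
        DependsOn (fun T => h (T + Pi.single a 1)) D := fun a hh x y hxy =>
      hh fun i hi => by simp [hxy i hi]
    have hle : ∀ {h : (Λ → ℕ) → ℝ} (a : Λ), Monotone h → ∀ T, h T ≤ h (T + Pi.single a 1) :=
      fun a hh T => hh (le_add_of_nonneg_right (Pi.single_nonneg.mpr zero_le_one))
    have heq : ∀ {h : (Λ → ℕ) → ℝ} {D : Set Λ} (a : Λ), DependsOn h D → a ∉ D →
        ∀ T, h (T + Pi.single a 1) = h T := fun a hh ha T =>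
      hh fun i hi => by
        have : i ≠ a := by rintro rfl; exact ha hi
        simp [this]
    -- Condition on the label `a` of the first sample: shifting the counts by one keeps monotonicity
    -- and the sets of relevant labels, so the induction hypothesis applies.
    have h1 : ∀ a, weightedMean (fun _ : Fin n => u) (fun L =>
        f (labelCount L + Pi.single a 1) * g (labelCount L + Pi.single a 1)) ≤ F a * G a :=
      fun a => ih (hf.comp (hshift a)) (hg.comp (hshift a)) (hdep a hfA) (hdep a hgB)
    have hFF : ∀ a, F0 ≤ F a := fun a => weightedMean_mono (fun _ => hu) fun L => hle a hf _
    have hGG : ∀ a, G0 ≤ G a := fun a => weightedMean_mono (fun _ => hu) fun L => hle a hg _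
    -- A label cannot lie in both `A` and `B`, so the first sample affects at most one of the two
    -- functions. Hence the mean of `F * G` equals the product of the means of `F` and `G` minus
    -- `(mean F - F0) * (mean G - G0)`, and this last product is nonnegative.
    have hz : ∀ a, (F a - F0) * (G a - G0) = 0 := by
      intro a
      by_cases ha : a ∈ A
      · have : G a = G0 := by
          simp only [hG, hG0, heq a hgB (Set.disjoint_left.mp hAB ha)]
        rw [this, sub_self, mul_zero]
      · have : F a = F0 := by
          simp only [hF, hF0, heq a hfA ha]
        rw [this, sub_self, zero_mul]
    have h2 : ∑ a, u a * (F a * G a)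
        = F0 * ∑ a, u a * G a + G0 * ∑ a, u a * F a - F0 * G0 := by
      have h3 : ∀ a, u a * (F a * G a)
          = F0 * (u a * G a) + G0 * (u a * F a) - F0 * G0 * u a := fun a => by
        linear_combination u a * hz a
      simp only [h3, Finset.sum_sub_distrib, Finset.sum_add_distrib, ← Finset.mul_sum, hu1,
        mul_one]
    have h4 : F0 ≤ ∑ a, u a * F a := by
      calc F0 = ∑ a, u a * F0 := by rw [← Finset.sum_mul, hu1, one_mul]
        _ ≤ _ := Finset.sum_le_sum fun a _ => mul_le_mul_of_nonneg_left (hFF a) (hu a)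
    have h5 : G0 ≤ ∑ a, u a * G a := by
      calc G0 = ∑ a, u a * G0 := by rw [← Finset.sum_mul, hu1, one_mul]
        _ ≤ _ := Finset.sum_le_sum fun a _ => mul_le_mul_of_nonneg_left (hGG a) (hu a)
    calc _ ≤ ∑ a, u a * (F a * G a) :=
          Finset.sum_le_sum fun a _ => mul_le_mul_of_nonneg_left (h1 a) (hu a)
      _ ≤ _ := by rw [h2]; nlinarith

lemma weightedMean_mul_le_of_antitone {u : Λ → ℝ} (hu : ∀ a, 0 ≤ u a) (hu1 : ∑ a, u a = 1)
    {A B : Set Λ} (hAB : Disjoint A B) {f g : (Λ → ℕ) → ℝ} (hf : Antitone f) (hg : Antitone g)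
    (hfA : DependsOn f A) (hgB : DependsOn g B) :
    weightedMean (fun _ : Fin n => u) (fun L => f (labelCount L) * g (labelCount L))
      ≤ weightedMean (fun _ : Fin n => u) (fun L => f (labelCount L)) *
        weightedMean (fun _ : Fin n => u) (fun L => g (labelCount L)) := by
  have h := weightedMean_mul_le_of_monotone (n := n) hu hu1 hAB (f := fun T => -1 * f T)
    (g := fun T => -1 * g T) (fun S T h => by simpa using hf h) (fun S T h => by simpa using hg h)
    (fun x y hxy => by simp [hfA hxy]) (fun x y hxy => by simp [hgB hxy])
  simp only [weightedMean_const_mul] at h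
  simpa using h

/-- Counts of independent labels are negatively associated. -/
lemma weightedMean_prod_le {u : Λ → ℝ} (hu : ∀ a, 0 ≤ u a) (hu1 : ∑ a, u a = 1)
    {g : Λ → ℕ → ℝ} (h0 : ∀ a T, 0 ≤ g a T)
    (hg : (∀ a, Monotone (g a)) ∨ (∀ a, Antitone (g a))) (s : Finset Λ) :
    weightedMean (fun _ : Fin n => u) (fun L => ∏ a ∈ s, g a (labelCount L a))
      ≤ ∏ a ∈ s, weightedMean (fun _ : Fin n => u) (fun L => g a (labelCount L a)) := by
  induction s using Finset.induction_on with
  | empty => simpa using (weightedMean_const (fun _ : Fin n => hu1) 1).le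
  | insert a s ha ih =>
    simp only [Finset.prod_insert ha]
    have hd : Disjoint ({a} : Set Λ) (⋃ b ∈ s, {b}) := by
      simp only [Set.disjoint_singleton_left, Set.mem_iUnion, Set.mem_singleton_iff, not_exists]
      rintro b hb rfl
      exact ha hb
    have hd1 : DependsOn (fun T : Λ → ℕ => g a (T a)) {a} := fun x y h => by
      simp only [h a rfl]
    have hd2 : DependsOn (fun T : Λ → ℕ => ∏ b ∈ s, g b (T b)) (⋃ b ∈ s, {b}) :=
      dependsOn_prod (S := fun b => {b}) (fun b x y h => by simp only [h b rfl]) s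
    refine le_trans ?_ (mul_le_mul_of_nonneg_left ih
      (weightedMean_nonneg (fun _ => hu) fun L => h0 _ _))
    rcases hg with hg | hg
    · exact weightedMean_mul_le_of_monotone hu hu1 hd (f := fun T => g a (T a))
        (g := fun T => ∏ b ∈ s, g b (T b)) (fun S T h => hg a (h a))
        (fun S T h => Finset.prod_le_prod (fun b _ => h0 _ _) fun b _ => hg b (h b)) hd1 hd2
    · exact weightedMean_mul_le_of_antitone hu hu1 hd (f := fun T => g a (T a))
        (g := fun T => ∏ b ∈ s, g b (T b)) (fun S T h => hg a (h a))
        (fun S T h => Finset.prod_le_prod (fun b _ => h0 _ _) fun b _ => hg b (h b)) hd1 hd2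

/-- Coefficients of one sign make all factors monotone in the same direction, as negative
association requires. Each factor has mean `1 + p (exp (c a) - 1)`, as for independent Bernoulli
variables. -/
lemma weightedMean_exp_sum_le {u : Λ → ℝ} (hu : ∀ a, 0 ≤ u a) (hu1 : ∑ a, u a = 1)
    {J : ℕ → Prop} [DecidablePred J] (hJ : (∀ a b, a ≤ b → J a → J b) ∨ (∀ a b, a ≤ b → J b → J a)) {p : ℝ}
    (hp : ∀ a, weightedProb (fun _ : Fin n => u) (fun L => J (labelCount L a)) = p)
    {c : Λ → ℝ} (hc : (∀ a, 0 ≤ c a) ∨ (∀ a, c a ≤ 0)) :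
    weightedMean (fun _ : Fin n => u)
        (fun L => Real.exp (∑ a, c a * if J (labelCount L a) then 1 else 0))
      ≤ Real.exp (p * ∑ a, (Real.exp (c a) - 1)) := by
  set g : Λ → ℕ → ℝ := fun a T => Real.exp (c a * if J T then 1 else 0) with hgdef
  have hup : (∀ a b, a ≤ b → J a → J b) → Monotone fun T => (if J T then (1 : ℝ) else 0) :=
    fun h a b hab => by
      by_cases ha : J a
      · simp [ha, h a b hab ha]
      · simp only [ha, if_false]; split_ifs <;> norm_num
  have hdown : (∀ a b, a ≤ b → J b → J a) → Antitone fun T => (if J T then (1 : ℝ) else 0) :=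
    fun h a b hab => by
      by_cases hb : J b
      · simp [hb, h a b hab hb]
      · simp only [hb, if_false]; split_ifs <;> norm_num
  have hg : (∀ a, Monotone (g a)) ∨ (∀ a, Antitone (g a)) := by
    rcases hJ with hJ | hJ <;> rcases hc with hc | hc
    · exact Or.inl fun a S T h => Real.exp_le_exp.mpr (mul_le_mul_of_nonneg_left (hup hJ h) (hc a))
    · exact Or.inr fun a S T h => Real.exp_le_exp.mpr (mul_le_mul_of_nonpos_left (hup hJ h) (hc a))
    · exact Or.inr fun a S T h =>
        Real.exp_le_exp.mpr (mul_le_mul_of_nonneg_left (hdown hJ h) (hc a))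
    · exact Or.inl fun a S T h =>
        Real.exp_le_exp.mpr (mul_le_mul_of_nonpos_left (hdown hJ h) (hc a))
  have h1 : ∀ a, weightedMean (fun _ : Fin n => u) (fun L => g a (labelCount L a))
      = 1 + (Real.exp (c a) - 1) * p := by
    intro a
    have h2 : ∀ T, g a T = 1 + (Real.exp (c a) - 1) * if J T then 1 else 0 := fun T => by
      simp only [hgdef]; split_ifs <;> simp
    simp only [h2]
    rw [weightedMean_add, weightedMean_const_mul, weightedMean_const fun _ => hu1, ← hp a, weightedProb]
    congr!
  simp only [Real.exp_sum]
  refine (weightedMean_prod_le hu hu1 (fun a T => (Real.exp_pos _).le) hg Finset.univ).trans ?_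
  rw [Finset.mul_sum, Real.exp_sum]
  refine Finset.prod_le_prod
    (fun a _ => weightedMean_nonneg (fun _ => hu) fun L => (Real.exp_pos _).le) fun a _ => ?_
  rw [h1 a, add_comm, mul_comm p]
  exact Real.add_one_le_exp _

/-- Fluctuations of a centred sum over the labels whose count lies in an up- or down-set. -/
lemma weightedMean_exp_centred_le {u : Λ → ℝ} (hu : ∀ a, 0 ≤ u a) (hu1 : ∑ a, u a = 1)
    {J : ℕ → Prop} [DecidablePred J] (hJ : (∀ a b, a ≤ b → J a → J b) ∨ (∀ a b, a ≤ b → J b → J a)) {p : ℝ}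
    (hp : ∀ a, weightedProb (fun _ : Fin n => u) (fun L => J (labelCount L a)) = p)
    {c : Λ → ℝ} (hc : ∀ a, |c a| ≤ 1) (hc0 : ∑ a, c a = 0) (s : ℝ) :
    weightedMean (fun _ : Fin n => u)
        (fun L => Real.exp (s * ∑ a, c a * if J (labelCount L a) then 1 else 0))
      ≤ Real.exp (2 * p * s ^ 2 * Real.exp (2 * |s|) * Fintype.card Λ) := by
  have hp0 : 0 ≤ p := by
    rcases isEmpty_or_nonempty Λ with h | ⟨⟨a⟩⟩
    · simp at hu1
    · exact hp a ▸ weightedProb_nonneg (fun _ => hu) _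
  -- The coefficients have mixed signs, so negative association does not apply directly.
  -- Cauchy–Schwarz separates the positive part from the negative part, at the cost of doubling the
  -- exponents.
  have h1 := weightedMean_mul_sq_le (w := fun _ : Fin n => u) (fun _ => hu)
    (fun L => Real.exp (∑ a, max (s * c a) 0 * if J (labelCount L a) then 1 else 0))
    (fun L => Real.exp (∑ a, min (s * c a) 0 * if J (labelCount L a) then 1 else 0))
  have h2 : ∀ L : Fin n → Λ,
      Real.exp (∑ a, max (s * c a) 0 * if J (labelCount L a) then 1 else 0) *
        Real.exp (∑ a, min (s * c a) 0 * if J (labelCount L a) then 1 else 0)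
      = Real.exp (s * ∑ a, c a * if J (labelCount L a) then 1 else 0) := by
    intro L
    rw [← Real.exp_add, ← Finset.sum_add_distrib, Finset.mul_sum]
    congr 1
    refine Finset.sum_congr rfl fun a _ => ?_
    rw [← add_mul, max_add_min, add_zero, mul_assoc]
  simp only [h2, ← Real.exp_nat_mul, Finset.mul_sum, ← mul_assoc] at h1
  have h3 := weightedMean_exp_sum_le (n := n) hu hu1 hJ hp
    (c := fun a => ((2 : ℕ) : ℝ) * max (s * c a) 0) (Or.inl fun a => by positivity)
  have h4 := weightedMean_exp_sum_le (n := n) hu hu1 hJ hp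
    (c := fun a => ((2 : ℕ) : ℝ) * min (s * c a) 0) (Or.inr fun a => by
      have := min_le_right (s * c a) 0
      push_cast; linarith)
  have h5 := h1.trans (mul_le_mul h3 h4
    (weightedMean_nonneg (fun _ => hu) fun L => (Real.exp_pos _).le) (Real.exp_pos _).le)
  rw [← Real.exp_add, ← mul_add, ← Finset.sum_add_distrib] at h5
  have h6 : ∀ a, (Real.exp (((2 : ℕ) : ℝ) * max (s * c a) 0) - 1) +
      (Real.exp (((2 : ℕ) : ℝ) * min (s * c a) 0) - 1)
        ≤ 2 * s * c a + 4 * s ^ 2 * Real.exp (2 * |s|) := by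
    intro a
    -- One of the two parts is zero, so the two contributions recombine without loss.
    have h7 : (Real.exp (((2 : ℕ) : ℝ) * max (s * c a) 0) - 1) +
      (Real.exp (((2 : ℕ) : ℝ) * min (s * c a) 0) - 1) = Real.exp (2 * s * c a) - 1 := by
      rcases le_total 0 (s * c a) with h | h
      · rw [max_eq_left h, min_eq_right h]; simp [mul_assoc]
      · rw [max_eq_right h, min_eq_left h]; simp [mul_assoc]
    have h8 := exp_mul_le_of_abs_le (s := 2 * s) (hc a)
    have h9 : c a ^ 2 ≤ 1 := by
      rw [← sq_abs]; exact pow_le_one₀ (abs_nonneg _) (hc a)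
    rw [h7]
    rw [one_mul, abs_mul, abs_two] at h8
    have h10 := mul_le_mul_of_nonneg_left h9
      (by positivity : 0 ≤ (2 * s) ^ 2 * Real.exp (2 * |s|))
    linarith
  have h7 := Finset.sum_le_sum fun a (_ : a ∈ Finset.univ) => h6 a
  -- The first-order terms cancel because `c` is centred. The square root from Cauchy–Schwarz later
  -- turns the factor `4` into `2`.
  have h9 : ∑ a, (2 * s * c a + 4 * s ^ 2 * Real.exp (2 * |s|))
      = Fintype.card Λ * (4 * s ^ 2 * Real.exp (2 * |s|)) := by
    rw [Finset.sum_add_distrib, ← Finset.mul_sum, hc0, mul_zero, zero_add, Finset.sum_const,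
      Finset.card_univ, nsmul_eq_mul]
  rw [h9] at h7
  have h8 := h5.trans (Real.exp_le_exp.mpr (mul_le_mul_of_nonneg_left h7 hp0))
  refine (abs_le_of_sq_le_sq' ?_ (Real.exp_pos _).le).2
  simp only [Finset.mul_sum, ← mul_assoc]
  refine h8.trans (le_of_eq ?_)
  rw [← Real.exp_nat_mul]
  congr 1
  push_cast
  ring

end LabelCount

/-! ### The law of a single label count -/

section Binomial

variable {Λ : Type*} [Fintype Λ] [DecidableEq Λ] {n : ℕ}

/-- Under a label-independent weight, exchanging two labels is a symmetry; this supplies the common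
probability `p` assumed in the tail bounds. -/
lemma weightedProb_labelCount_swap (q : ℝ) (J : ℕ → Prop) (a b : Λ) :
    weightedProb (fun (_ : Fin n) (_ : Λ) => q) (fun L => J (labelCount L a))
      = weightedProb (fun (_ : Fin n) (_ : Λ) => q) (fun L => J (labelCount L b)) := by
  classical
  simp only [weightedProb, weightedMean]
  rw [← ((Equiv.refl (Fin n)).arrowCongr (Equiv.swap a b)).sum_comp]
  refine Finset.sum_congr rfl fun L _ => ?_
  have h : labelCount ((Equiv.refl (Fin n)).arrowCongr (Equiv.swap a b) L) a = labelCount L b := by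
    simp only [labelCount]
    congr 1
    ext t
    simp only [Equiv.arrowCongr_apply, Equiv.refl_symm, Equiv.coe_refl, Function.comp_apply, id,
      Finset.mem_filter, Finset.mem_univ, true_and]
    rw [← Equiv.eq_symm_apply, Equiv.symm_swap, Equiv.swap_apply_left]
  simp only [h]

lemma weightedMean_exp_neg_labelCount_le {u : Λ → ℝ} (hu1 : ∑ a, u a = 1)
    (hu : ∀ a, 0 ≤ u a) (a : Λ) :
    weightedMean (fun _ : Fin n => u) (fun L => Real.exp (-(labelCount L a : ℝ)))
      ≤ Real.exp (-(n * u a / 2)) := by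
  have h1 : ∀ L : Fin n → Λ, Real.exp (-(labelCount L a : ℝ))
      = ∏ t, if L t = a then Real.exp (-1) else 1 := by
    intro L
    rw [Finset.prod_ite, Finset.prod_const, Finset.prod_const_one, mul_one, ← Real.exp_nat_mul]
    simp [labelCount]
  simp only [h1]
  rw [weightedMean_prod fun _ b => if b = a then Real.exp (-1) else 1, Finset.prod_const,
    Finset.card_univ, Fintype.card_fin]
  have h2 : ∑ b, u b * (if b = a then Real.exp (-1) else 1) = 1 - u a * (1 - Real.exp (-1)) := by
    have : ∀ b, u b * (if b = a then Real.exp (-1) else 1)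
        = u b - if b = a then u b * (1 - Real.exp (-1)) else 0 := fun b => by
      split_ifs <;> ring
    simp [this, hu1]
  have h3 : Real.exp (-1) ≤ 1 / 2 := by
    rw [Real.exp_neg, inv_le_comm₀ (Real.exp_pos _) (by norm_num)]
    have := Real.add_one_le_exp 1
    norm_num at this ⊢; exact this
  have h4 : 1 - u a * (1 - Real.exp (-1)) ≤ Real.exp (-(u a / 2)) := by
    have := Real.add_one_le_exp (-(u a / 2))
    nlinarith [hu a]
  rw [h2]
  have h5 : u a ≤ 1 := hu1 ▸ Finset.single_le_sum (fun b _ => hu b) (Finset.mem_univ a)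
  refine (pow_le_pow_left₀ (by nlinarith [hu a, Real.exp_pos (-1)]) h4 n).trans (le_of_eq ?_)
  rw [← Real.exp_nat_mul]
  congr 1
  ring

lemma weightedProb_labelCount_lt_le {u : Λ → ℝ} (hu : ∀ a, 0 ≤ u a) (hu1 : ∑ a, u a = 1)
    (a : Λ) (y : ℝ) :
    weightedProb (fun _ : Fin n => u) (fun L => (labelCount L a : ℝ) < y)
      ≤ Real.exp (y - n * u a / 2) := by
  have h := weightedProb_le_of_le_exp (w := fun _ : Fin n => u) (fun _ => hu)
    (A := fun L => (labelCount L a : ℝ) < y) (f := fun L => -(labelCount L a : ℝ)) (u := -y)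
    fun L hL => by linarith
  refine h.trans ?_
  rw [neg_neg, sub_eq_add_neg, Real.exp_add]
  exact mul_le_mul_of_nonneg_left (weightedMean_exp_neg_labelCount_le hu1 hu a) (Real.exp_pos _).le

lemma le_weightedProb_le_labelCount {u : Λ → ℝ} (hu : ∀ a, 0 ≤ u a) (hu1 : ∑ a, u a = 1)
    (a : Λ) (k : ℕ) :
    (n.choose k : ℝ) * (u a ^ k * (1 - u a) ^ (n - k))
      ≤ weightedProb (fun _ : Fin n => u) (fun L => k ≤ labelCount L a) := by
  classical
  -- The product over `t` of these factors is the indicator that `S` is exactly the set of samples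
  -- labelled `a`. Summing over the `S` of size `k` gives the event that the count equals `k`, whose
  -- binomial probability is the lower bound.
  set h : Finset (Fin n) → Fin n → Λ → ℝ := fun S t b =>
    if t ∈ S then (if b = a then 1 else 0) else (if b = a then 0 else 1) with hh
  have h1 : ∀ S ∈ (Finset.univ : Finset (Fin n)).powersetCard k,
      weightedMean (fun _ : Fin n => u) (fun L => ∏ t, h S t (L t))
        = u a ^ k * (1 - u a) ^ (n - k) := by
    intro S hS
    rw [weightedMean_prod]
    have h2 : ∀ t, ∑ b, u b * h S t b = if t ∈ S then u a else 1 - u a := by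
      intro t
      by_cases ht : t ∈ S
      · simp [hh, ht]
      · have : ∀ b, u b * (if b = a then (0 : ℝ) else 1) = u b - if b = a then u b else 0 :=
          fun b => by split_ifs <;> ring
        simp [hh, ht, this, hu1]
    simp only [h2]
    have hc := (Finset.mem_powersetCard.mp hS).2
    rw [Finset.prod_ite, Finset.prod_const, Finset.prod_const, Finset.filter_mem_eq_inter,
      Finset.univ_inter, hc, Finset.filter_not, Finset.filter_mem_eq_inter, Finset.univ_inter,
      Finset.card_sdiff_of_subset (Finset.subset_univ _), Finset.card_univ, Fintype.card_fin, hc]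
  have h3 : ∀ (S : Finset (Fin n)) (L : Fin n → Λ), ∏ t, h S t (L t)
      = if S = Finset.univ.filter (fun t => L t = a) then 1 else 0 := by
    intro S L
    split_ifs with hS
    · refine Finset.prod_eq_one fun t _ => ?_
      by_cases ht : L t = a <;> simp [hh, hS, ht]
    · obtain ⟨t, ht⟩ : ∃ t, ¬ (t ∈ S ↔ L t = a) := by
        by_contra hcon
        push Not at hcon
        exact hS (by ext t; simp [hcon t])
      refine Finset.prod_eq_zero (Finset.mem_univ t) ?_
      by_cases h4 : t ∈ S <;> by_cases h5 : L t = a <;> simp_all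
  have h4 : (n.choose k : ℝ) * (u a ^ k * (1 - u a) ^ (n - k))
      = weightedMean (fun _ : Fin n => u) (fun L =>
        ∑ S ∈ (Finset.univ : Finset (Fin n)).powersetCard k, ∏ t, h S t (L t)) := by
    rw [weightedMean_sum, Finset.sum_congr rfl h1, Finset.sum_const, Finset.card_powersetCard,
      Finset.card_univ, Fintype.card_fin, nsmul_eq_mul]
  rw [h4]
  refine weightedMean_mono (fun _ => hu) fun L => ?_
  simp only [h3]
  rw [Finset.sum_ite_eq']
  split_ifs with h5 h6
  · exact le_rfl
  · exact absurd (Finset.mem_powersetCard.mp h5).2.ge h6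
  · norm_num
  · exact le_rfl

end Binomial

/-! ### U-statistics of independent signs -/

section UStatistic

variable {ι : Type*} [DecidableEq ι]

/-- The U-statistic of order `k` of the values `y` on `S`. -/
def uMean (k : ℕ) (S : Finset ι) (y : ι → ℝ) : ℝ :=
  (1 / (S.card.choose k : ℝ)) * ∑ s ∈ S.powersetCard k, ∏ t ∈ s, y t

lemma abs_prod_le_one {s : Finset ι} {y : ι → ℝ} (hy : ∀ t, |y t| ≤ 1) : |∏ t ∈ s, y t| ≤ 1 := by
  rw [Finset.abs_prod]
  exact Finset.prod_le_one (fun _ _ => abs_nonneg _) fun t _ => hy t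

lemma abs_uMean_le_one (k : ℕ) (S : Finset ι) {y : ι → ℝ} (hy : ∀ t, |y t| ≤ 1) :
    |uMean k S y| ≤ 1 := by
  rw [uMean, abs_mul, abs_of_nonneg (by positivity)]
  have h : |∑ s ∈ S.powersetCard k, ∏ t ∈ s, y t| ≤ (S.card.choose k : ℝ) := by
    refine (Finset.abs_sum_le_sum_abs _ _).trans ?_
    refine (Finset.sum_le_sum fun s _ => abs_prod_le_one hy).trans ?_
    simp
  rw [one_div]
  exact (mul_le_mul_of_nonneg_left h (by positivity)).trans inv_mul_le_one

lemma card_filter_mem_powersetCard {S : Finset ι} {t : ι} (ht : t ∈ S) {k : ℕ} (hk : 1 ≤ k) :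
    ((S.powersetCard k).filter (fun s => t ∈ s)).card = (S.card - 1).choose (k - 1) := by
  obtain ⟨j, rfl⟩ : ∃ j, k = j + 1 := ⟨k - 1, by omega⟩
  have h1 : (S.powersetCard (j + 1)).filter (fun s => t ∈ s)
      = ((S.erase t).powersetCard j).image (insert t) := by
    ext s
    simp only [Finset.mem_filter, Finset.mem_powersetCard, Finset.mem_image]
    constructor
    · rintro ⟨⟨h1, h2⟩, h3⟩
      refine ⟨s.erase t, ⟨Finset.erase_subset_erase t h1, ?_⟩, Finset.insert_erase h3⟩
      rw [Finset.card_erase_of_mem h3, h2]; rfl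
    · rintro ⟨r, ⟨h1, h2⟩, rfl⟩
      have h3 : t ∉ r := fun h => (Finset.mem_erase.mp (h1 h)).1 rfl
      refine ⟨⟨Finset.insert_subset ht (h1.trans (Finset.erase_subset _ _)), ?_⟩,
        Finset.mem_insert_self _ _⟩
      rw [Finset.card_insert_of_notMem h3, h2]
  rw [h1, Finset.card_image_of_injOn, Finset.card_powersetCard, Finset.card_erase_of_mem ht]
  · rfl
  · intro r hr r' hr' h
    have h3 : ∀ r : Finset ι, r ∈ (↑((S.erase t).powersetCard j) : Set (Finset ι)) → t ∉ r :=
      fun r hr h => (Finset.mem_erase.mp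
        ((Finset.mem_powersetCard.mp (Finset.mem_coe.mp hr)).1 h)).1 rfl
    rw [← Finset.erase_insert (h3 r hr), ← Finset.erase_insert (h3 r' hr')]
    exact congrArg (fun s => s.erase t) h

/-- Count the intersecting pairs through a shared element: with `T = S.card` there are at most `(T
choose k) * k * (T-1 choose k-1)`, and `T * (T-1 choose k-1) = k * (T choose k)`. -/
lemma card_not_disjoint_mul_card_le (S : Finset ι) {k : ℕ} (hk : 1 ≤ k) (hS : k ≤ S.card) :
    (((S.powersetCard k ×ˢ S.powersetCard k).filter fun z => ¬ Disjoint z.1 z.2).card : ℝ)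
      ≤ (S.card.choose k : ℝ) ^ 2 * (k ^ 2 / S.card) := by
  have h1 : ((S.powersetCard k ×ˢ S.powersetCard k).filter fun z => ¬ Disjoint z.1 z.2).card
      ≤ ∑ s ∈ S.powersetCard k, ∑ t ∈ s, ((S.powersetCard k).filter (fun s => t ∈ s)).card := by
    rw [Finset.card_filter, Finset.sum_product]
    refine Finset.sum_le_sum fun s hs => ?_
    simp only [Finset.card_filter]
    rw [Finset.sum_comm]
    refine Finset.sum_le_sum fun r hr => ?_
    split_ifs with h
    · exact Nat.zero_le _
    · obtain ⟨t, ht, ht'⟩ := Finset.not_disjoint_iff.mp h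
      have := Finset.single_le_sum (f := fun t => if t ∈ r then 1 else 0)
        (fun t _ => Nat.zero_le _) ht
      simpa only [ht', if_true] using this
  have h2 : ∑ s ∈ S.powersetCard k, ∑ t ∈ s, ((S.powersetCard k).filter (fun s => t ∈ s)).card
      = S.card.choose k * (k * (S.card - 1).choose (k - 1)) := by
    have : ∀ s ∈ S.powersetCard k,
        ∑ t ∈ s, ((S.powersetCard k).filter (fun s => t ∈ s)).card
          = k * (S.card - 1).choose (k - 1) := by
      intro s hs
      obtain ⟨h3, h4⟩ := Finset.mem_powersetCard.mp hs
      rw [Finset.sum_congr rfl fun t ht => card_filter_mem_powersetCard (h3 ht) hk,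
        Finset.sum_const, h4, smul_eq_mul]
    rw [Finset.sum_congr rfl this, Finset.sum_const, Finset.card_powersetCard, smul_eq_mul]
  have h3 : (S.card : ℝ) * (S.card - 1).choose (k - 1) = S.card.choose k * k := by
    have := Nat.add_one_mul_choose_eq (S.card - 1) (k - 1)
    rw [Nat.sub_add_cancel hk, Nat.sub_add_cancel (hk.trans hS)] at this
    exact_mod_cast this
  have h4 : (0 : ℝ) < S.card := by exact_mod_cast hk.trans hS
  refine (Nat.cast_le.mpr (h1.trans h2.le)).trans (le_of_eq ?_)
  push_cast
  field_simp
  linear_combination (S.card.choose k : ℝ) * h3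

variable [Fintype ι] {α : Type*} [Fintype α]

lemma dependsOn_prod_comp (s : Finset ι) (R : α → ℝ) :
    DependsOn (fun x : ι → α => ∏ t ∈ s, R (x t)) (s : Set ι) := fun _ _ h =>
  Finset.prod_congr rfl fun t ht => by rw [h t ht]

lemma weightedMean_prod_subset {v : ι → α → ℝ} (hv1 : ∀ i, ∑ a, v i a = 1) {R : α → ℝ}
    {S s : Finset ι} {μ : ℝ} (hμ : ∀ t ∈ S, ∑ a, v t a * R a = μ) (hs : s ⊆ S) :
    weightedMean v (fun x => ∏ t ∈ s, R (x t)) = μ ^ s.card := by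
  have h1 : ∀ x : ι → α, ∏ t ∈ s, R (x t) = ∏ t, if t ∈ s then R (x t) else 1 := fun x => by
    simp
  simp only [h1]
  rw [weightedMean_prod fun t a => if t ∈ s then R a else 1]
  have h2 : ∀ t, ∑ a, v t a * (if t ∈ s then R a else 1) = if t ∈ s then μ else 1 := by
    intro t
    by_cases ht : t ∈ s
    · simpa [ht] using hμ t (hs ht)
    · simpa [ht] using hv1 t
  simp only [h2]
  simp

lemma weightedMean_uMean {v : ι → α → ℝ} (hv1 : ∀ i, ∑ a, v i a = 1) {R : α → ℝ}
    {S : Finset ι} {μ : ℝ} (hμ : ∀ t ∈ S, ∑ a, v t a * R a = μ) {k : ℕ} (hS : k ≤ S.card) :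
    weightedMean v (fun x => uMean k S fun t => R (x t)) = μ ^ k := by
  simp only [uMean]
  rw [weightedMean_const_mul, weightedMean_sum]
  rw [Finset.sum_congr rfl fun s hs => weightedMean_prod_subset hv1 hμ
    (Finset.mem_powersetCard.mp hs).1]
  rw [Finset.sum_congr rfl fun s hs => by rw [(Finset.mem_powersetCard.mp hs).2]]
  rw [Finset.sum_const, Finset.card_powersetCard, nsmul_eq_mul]
  have : (S.card.choose k : ℝ) ≠ 0 := by exact_mod_cast (Nat.choose_pos hS).ne'
  field_simp

lemma weightedMean_uMean_sub_sq_le_one {v : ι → α → ℝ} (hv : ∀ i a, 0 ≤ v i a)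
    (hv1 : ∀ i, ∑ a, v i a = 1) {R : α → ℝ} (hR : ∀ a, |R a| ≤ 1)
    {S : Finset ι} {μ : ℝ} (hμ : ∀ t ∈ S, ∑ a, v t a * R a = μ) {k : ℕ} (hS : k ≤ S.card) :
    weightedMean v (fun x => (uMean k S (fun t => R (x t)) - μ ^ k) ^ 2) ≤ 1 := by
  have h1 : ∀ x : ι → α, (uMean k S (fun t => R (x t)) - μ ^ k) ^ 2
      ≤ (1 + (μ ^ k) ^ 2) - 2 * μ ^ k * uMean k S (fun t => R (x t)) := fun x => by
    have := (sq_le_one_iff_abs_le_one _).mpr (abs_uMean_le_one k S fun t => hR (x t))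
    nlinarith
  refine (weightedMean_mono hv h1).trans ?_
  rw [weightedMean_sub, weightedMean_const hv1, weightedMean_const_mul,
    weightedMean_uMean hv1 hμ hS]
  nlinarith [sq_nonneg (μ ^ k)]

/-- Expand the square into covariances of pairs of `k`-subsets. Disjoint pairs contribute zero and
intersecting pairs at most `1`, and intersecting pairs are at most a fraction `k² / T` of all pairs.
-/
lemma weightedMean_uMean_sub_sq_le {v : ι → α → ℝ} (hv : ∀ i a, 0 ≤ v i a)
    (hv1 : ∀ i, ∑ a, v i a = 1) {R : α → ℝ} (hR : ∀ a, |R a| ≤ 1)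
    {S : Finset ι} {μ : ℝ} (hμ : ∀ t ∈ S, ∑ a, v t a * R a = μ) {k : ℕ} (hk : 1 ≤ k)
    (hS : k ≤ S.card) :
    weightedMean v (fun x => (uMean k S (fun t => R (x t)) - μ ^ k) ^ 2) ≤ k ^ 2 / S.card := by
  have hC : (0 : ℝ) < S.card.choose k := by exact_mod_cast Nat.choose_pos hS
  set P := S.powersetCard k with hP
  have h1 : ∀ x : ι → α, (uMean k S (fun t => R (x t)) - μ ^ k) ^ 2
      = (1 / (S.card.choose k : ℝ)) ^ 2 * ∑ z ∈ P ×ˢ P,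
        (∏ t ∈ z.1, R (x t) - μ ^ k) * (∏ t ∈ z.2, R (x t) - μ ^ k) := by
    intro x
    have h2 : uMean k S (fun t => R (x t)) - μ ^ k
        = (1 / (S.card.choose k : ℝ)) * ∑ s ∈ P, (∏ t ∈ s, R (x t) - μ ^ k) := by
      rw [Finset.sum_sub_distrib, Finset.sum_const, hP, Finset.card_powersetCard, nsmul_eq_mul,
        mul_sub, uMean]
      field_simp
    rw [h2, mul_pow, sq (∑ s ∈ P, _), Finset.sum_mul_sum, Finset.sum_product]
  have h2 : ∀ z ∈ P ×ˢ P, weightedMean v (fun x =>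
      (∏ t ∈ z.1, R (x t) - μ ^ k) * (∏ t ∈ z.2, R (x t) - μ ^ k))
        ≤ if ¬ Disjoint z.1 z.2 then 1 else 0 := by
    intro z hz
    obtain ⟨hz1, hz2⟩ := Finset.mem_product.mp hz
    obtain ⟨hz1, hz1'⟩ := Finset.mem_powersetCard.mp hz1
    obtain ⟨hz2, hz2'⟩ := Finset.mem_powersetCard.mp hz2
    have hm1 := weightedMean_prod_subset hv1 hμ hz1
    have hm2 := weightedMean_prod_subset hv1 hμ hz2
    rw [hz1'] at hm1
    rw [hz2'] at hm2
    split_ifs with hd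
    · rw [weightedMean_mul_of_dependsOn hv1 (S := (z.1 : Set ι)) (T := (z.2 : Set ι))
        (fun x y h => by simp only [dependsOn_prod_comp z.1 R h])
        (fun x y h => by simp only [dependsOn_prod_comp z.2 R h])
        (Finset.disjoint_coe.mpr hd), weightedMean_sub, weightedMean_const hv1, hm1, sub_self,
        zero_mul]
    -- Bounding the product of the two monomials by `1` leaves a covariance of at most `1 - (μ ^ k)
    -- ^ 2`.
    · have h3 : ∀ x : ι → α, (∏ t ∈ z.1, R (x t) - μ ^ k) * (∏ t ∈ z.2, R (x t) - μ ^ k)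
          ≤ (1 + (μ ^ k) ^ 2) - μ ^ k * (∏ t ∈ z.1, R (x t) + ∏ t ∈ z.2, R (x t)) := fun x => by
        have h4 : (∏ t ∈ z.1, R (x t)) * (∏ t ∈ z.2, R (x t)) ≤ 1 := by
          refine (le_abs_self _).trans ?_
          rw [abs_mul]
          exact mul_le_one₀ (abs_prod_le_one fun t => hR (x t)) (abs_nonneg _)
            (abs_prod_le_one fun t => hR (x t))
        nlinarith
      refine (weightedMean_mono hv h3).trans ?_
      rw [weightedMean_sub, weightedMean_const hv1, weightedMean_const_mul, weightedMean_add,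
        hm1, hm2]
      nlinarith [sq_nonneg (μ ^ k)]
  simp only [h1]
  rw [weightedMean_const_mul, weightedMean_sum]
  have h3 := (Finset.sum_le_sum h2).trans (le_of_eq (by rw [Finset.sum_boole])) |>.trans
    (card_not_disjoint_mul_card_le S hk hS)
  refine (mul_le_mul_of_nonneg_left h3 (by positivity)).trans (le_of_eq ?_)
  field_simp

lemma weightedMean_exp_uMean_sub_le {v : ι → α → ℝ} (hv : ∀ i a, 0 ≤ v i a)
    (hv1 : ∀ i, ∑ a, v i a = 1) {R : α → ℝ} (hR : ∀ a, |R a| ≤ 1)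
    {S : Finset ι} {μ : ℝ} (hμ : ∀ t ∈ S, ∑ a, v t a * R a = μ) (hμ1 : |μ| ≤ 1) {k : ℕ}
    (hS : k ≤ S.card) {V : ℝ}
    (hV : weightedMean v (fun x => (uMean k S (fun t => R (x t)) - μ ^ k) ^ 2) ≤ V) (s : ℝ) :
    weightedMean v (fun x => Real.exp (s * (uMean k S (fun t => R (x t)) - μ ^ k)))
      ≤ Real.exp (s ^ 2 * Real.exp (2 * |s|) * V) := by
  have h1 : ∀ x : ι → α, |uMean k S (fun t => R (x t)) - μ ^ k| ≤ 2 := fun x => by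
    have h2 := abs_uMean_le_one k S fun t => hR (x t)
    have h3 : |μ ^ k| ≤ 1 := by rw [abs_pow]; exact pow_le_one₀ (abs_nonneg _) hμ1
    exact (abs_sub _ _).trans (by linarith)
  refine (weightedMean_mono hv fun x => exp_mul_le_of_abs_le (s := s) (h1 x)).trans ?_
  rw [weightedMean_add, weightedMean_add, weightedMean_const hv1, weightedMean_const_mul,
    weightedMean_const_mul, weightedMean_sub, weightedMean_const hv1,
    weightedMean_uMean hv1 hμ hS, sub_self, mul_zero, add_zero, add_comm]
  exact (add_le_add_left (mul_le_mul_of_nonneg_left hV (by positivity)) 1).trans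
    (Real.add_one_le_exp _)

end UStatistic

/-! ### Tail bounds for the averaged U-statistics -/

section Tail

variable {Λ β : Type*} [Fintype Λ] [DecidableEq Λ] [Fintype β] {n : ℕ}

/-- The samples with label `ℓ`. -/
def labelFiber (L : Fin n → Λ) (ℓ : Λ) : Finset (Fin n) := Finset.univ.filter fun t => L t = ℓ

/-- The labels that occur at least `k` times. -/
def frequentLabels (k : ℕ) (L : Fin n → Λ) : Finset Λ :=
  Finset.univ.filter fun ℓ => k ≤ labelCount L ℓ

/-- The average of the U-statistics of order `k` over the labels that occur at least `k` times. -/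
def meanUMean (k : ℕ) (L : Fin n → Λ) (y : Fin n → ℝ) : ℝ :=
  (1 / ((frequentLabels k L).card : ℝ)) * ∑ ℓ ∈ frequentLabels k L, uMean k (labelFiber L ℓ) y

lemma weightedMean_pair (u : Λ → ℝ) (v : Λ → β → ℝ) (f : (Fin n → Λ × β) → ℝ) :
    weightedMean (fun _ z => u z.1 * v z.1 z.2) f
      = weightedMean (fun _ : Fin n => u) (fun L =>
          weightedMean (fun t => v (L t)) fun b => f fun t => (L t, b t)) := by
  simp only [weightedMean]
  rw [← (Equiv.arrowProdEquivProdArrow (Fin n) (fun _ => Λ) (fun _ => β)).symm.sum_comp,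
    Fintype.sum_prod_type]
  refine Finset.sum_congr rfl fun L _ => ?_
  rw [Finset.mul_sum]
  refine Finset.sum_congr rfl fun b _ => ?_
  have h : (Equiv.arrowProdEquivProdArrow (Fin n) (fun _ => Λ) (fun _ => β)).symm (L, b)
      = fun t => (L t, b t) := rfl
  simp only [h, Finset.prod_mul_distrib]
  ring

/-- Draw the labels first and the outcomes afterwards: `A` collects the bad label configurations,
and `η` bounds the conditional failure on the others. -/
lemma weightedProb_pair_le {u : Λ → ℝ} (hu : ∀ a, 0 ≤ u a) (hu1 : ∑ a, u a = 1)
    {v : Λ → β → ℝ} (hv : ∀ a b, 0 ≤ v a b) (hv1 : ∀ a, ∑ b, v a b = 1)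
    {E : (Fin n → Λ × β) → Prop} (A : (Fin n → Λ) → Prop) {η : ℝ} (hη : 0 ≤ η)
    (h : ∀ L, ¬ A L → weightedProb (fun t => v (L t)) (fun b => E fun t => (L t, b t)) ≤ η) :
    weightedProb (fun _ z => u z.1 * v z.1 z.2) E ≤ weightedProb (fun _ : Fin n => u) A + η := by
  classical
  rw [weightedProb, weightedMean_pair]
  calc _ ≤ weightedMean (fun _ : Fin n => u) (fun L => (if A L then 1 else 0) + η) := by
        refine weightedMean_mono (fun _ => hu) fun L => ?_
        by_cases hA : A L
        · simp only [hA, if_true]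
          have := weightedProb_le_one (w := fun t => v (L t)) (fun t => hv (L t))
            (fun t => hv1 (L t)) (fun b => E fun t => (L t, b t))
          rw [weightedProb] at this
          linarith
        · simp only [hA, if_false, zero_add]
          exact h L hA
    _ = _ := by
        rw [weightedMean_add, weightedMean_const fun _ => hu1, weightedProb]

variable {v : Λ → β → ℝ} {R : β → ℝ} {μ : Λ → ℝ} {k : ℕ}

/-- The fluctuation of the U-statistics around their means, the labels being given. -/
lemma weightedProb_abs_sum_uMean_sub_le (hv : ∀ a b, 0 ≤ v a b) (hv1 : ∀ a, ∑ b, v a b = 1)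
    (hR : ∀ b, |R b| ≤ 1) (hμ : ∀ a, ∑ b, v a b * R b = μ a) (hμ1 : ∀ a, |μ a| ≤ 1)
    (L : Fin n → Λ) {V : Λ → ℝ}
    (hV : ∀ ℓ ∈ frequentLabels k L, weightedMean (fun t => v (L t))
      (fun b => (uMean k (labelFiber L ℓ) (fun t => R (b t)) - μ ℓ ^ k) ^ 2) ≤ V ℓ)
    {s y : ℝ} (hs : 0 ≤ s) :
    weightedProb (fun t => v (L t)) (fun b => y ≤ |∑ ℓ ∈ frequentLabels k L,
        (uMean k (labelFiber L ℓ) (fun t => R (b t)) - μ ℓ ^ k)|)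
      ≤ 2 * Real.exp (s ^ 2 * Real.exp (2 * s) * ∑ ℓ ∈ frequentLabels k L, V ℓ - s * y) := by
  have hw : ∀ t b, 0 ≤ v (L t) b := fun t => hv (L t)
  have hw1 : ∀ t, ∑ b, v (L t) b = 1 := fun t => hv1 (L t)
  have key : ∀ s' : ℝ, |s'| = s → weightedMean (fun t => v (L t)) (fun b => Real.exp (s' *
      ∑ ℓ ∈ frequentLabels k L, (uMean k (labelFiber L ℓ) (fun t => R (b t)) - μ ℓ ^ k)))
      ≤ Real.exp (s ^ 2 * Real.exp (2 * s) * ∑ ℓ ∈ frequentLabels k L, V ℓ) := by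
    intro s' hs'
    simp only [Finset.mul_sum, Real.exp_sum]
    -- Given the labels, the U-statistics use disjoint sets of samples, so the exponential moment
    -- factorizes.
    rw [weightedMean_prod_of_dependsOn (S := fun ℓ => (labelFiber L ℓ : Set (Fin n))) hw1]
    · refine Finset.prod_le_prod
        (fun ℓ _ => weightedMean_nonneg hw fun _ => (Real.exp_pos _).le) fun ℓ hℓ => ?_
      have h := weightedMean_exp_uMean_sub_le hw hw1 hR (S := labelFiber L ℓ) (μ := μ ℓ)
        (fun t ht => by rw [(Finset.mem_filter.mp ht).2]; exact hμ ℓ) (hμ1 ℓ)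
        (Finset.mem_filter.mp hℓ).2 (hV ℓ hℓ) s'
      rwa [hs', ← sq_abs, hs'] at h
    · intro ℓ x y hxy
      have : uMean k (labelFiber L ℓ) (fun t => R (x t))
          = uMean k (labelFiber L ℓ) (fun t => R (y t)) := by
        simp only [uMean]
        congr 1
        refine Finset.sum_congr rfl fun s hs => Finset.prod_congr rfl fun t ht => ?_
        rw [hxy t ((Finset.mem_powersetCard.mp hs).1 ht)]
      simp only [this]
    · intro a b hab
      simp only [Function.onFun, Finset.disjoint_coe]
      refine Finset.disjoint_left.mpr fun t ha hb => hab ?_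
      exact (Finset.mem_filter.mp ha).2.symm.trans (Finset.mem_filter.mp hb).2
  refine (weightedProb_abs_le hw hs (fun b hb => hb) (key s (abs_of_nonneg hs))
    (key (-s) (by rw [abs_neg, abs_of_nonneg hs]))).trans (le_of_eq ?_)
  rw [← Real.exp_add]
  congr 2
  ring

/-- The split into selection bias and fluctuation, each allowed `t`. Nonemptiness excludes the
default value `0` of the average. -/
lemma abs_meanUMean_sub_le (L : Fin n → Λ) (y : Fin n → ℝ) (f : Λ → ℝ) {F t : ℝ}
    (h0 : (frequentLabels k L).Nonempty)
    (h1 : |∑ ℓ ∈ frequentLabels k L, (f ℓ - F)| ≤ (frequentLabels k L).card * t)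
    (h2 : |∑ ℓ ∈ frequentLabels k L, (uMean k (labelFiber L ℓ) y - f ℓ)|
      ≤ (frequentLabels k L).card * t) :
    |meanUMean k L y - F| ≤ 2 * t := by
  have hm : (0 : ℝ) < (frequentLabels k L).card := by exact_mod_cast h0.card_pos
  have h3 : meanUMean k L y - F = (∑ ℓ ∈ frequentLabels k L, (uMean k (labelFiber L ℓ) y - f ℓ)
      + ∑ ℓ ∈ frequentLabels k L, (f ℓ - F)) / (frequentLabels k L).card := by
    rw [← Finset.sum_add_distrib]
    simp only [sub_add_sub_cancel]
    rw [Finset.sum_sub_distrib, Finset.sum_const, nsmul_eq_mul, meanUMean]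
    field_simp
  rw [h3, abs_div, abs_of_pos hm, div_le_iff₀ hm]
  exact (abs_add_le _ _).trans (by linarith)

lemma weightedProb_meanUMean_le {u : Λ → ℝ} (hu : ∀ a, 0 ≤ u a) (hu1 : ∑ a, u a = 1)
    (hv : ∀ a b, 0 ≤ v a b) (hv1 : ∀ a, ∑ b, v a b = 1) {F t η : ℝ} (hη : 0 ≤ η)
    (A : (Fin n → Λ) → Prop) (h0 : ∀ L, ¬ A L → (frequentLabels k L).Nonempty)
    (h1 : ∀ L, ¬ A L →
      |∑ ℓ ∈ frequentLabels k L, (μ ℓ ^ k - F)| ≤ (frequentLabels k L).card * t)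
    (h2 : ∀ L, ¬ A L → weightedProb (fun t => v (L t)) (fun b =>
      (frequentLabels k L).card * t ≤ |∑ ℓ ∈ frequentLabels k L,
        (uMean k (labelFiber L ℓ) (fun t => R (b t)) - μ ℓ ^ k)|) ≤ η) :
    weightedProb (fun _ z => u z.1 * v z.1 z.2) (fun x : Fin n → Λ × β =>
        2 * t < |meanUMean k (fun i => (x i).1) (fun i => R (x i).2) - F|)
      ≤ weightedProb (fun _ : Fin n => u) A + η := by
  refine weightedProb_pair_le hu hu1 hv hv1 A hη fun L hL => ?_
  refine (weightedProb_mono (fun t => hv (L t)) fun b hb => ?_).trans (h2 L hL)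
  by_contra hcon
  exact absurd hb (not_lt.mpr
    (abs_meanUMean_sub_le L _ _ (h0 L hL) (h1 L hL) (not_le.mp hcon).le))

end Tail

/-! ### Tail bounds for uniform labels in the two regimes -/

section UniformTail

variable {Λ β : Type*} [Fintype Λ] [DecidableEq Λ] [Fintype β] {n : ℕ}
variable {v : Λ → β → ℝ} {R : β → ℝ} {μ : Λ → ℝ} {k : ℕ}

lemma sum_frequentLabels (k : ℕ) (L : Fin n → Λ) (c : Λ → ℝ) :
    ∑ ℓ ∈ frequentLabels k L, c ℓ = ∑ ℓ, c ℓ * if k ≤ labelCount L ℓ then 1 else 0 := by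
  rw [frequentLabels, Finset.sum_filter]
  exact Finset.sum_congr rfl fun ℓ _ => by split_ifs <;> simp

lemma abs_sub_mean_le_one {f : Λ → ℝ} (hf0 : ∀ a, 0 ≤ f a) (hf1 : ∀ a, f a ≤ 1) (a : Λ) :
    |f a - (Fintype.card Λ : ℝ)⁻¹ * ∑ b, f b| ≤ 1 := by
  have : Nonempty Λ := ⟨a⟩
  have hQ : (0 : ℝ) < Fintype.card Λ := by exact_mod_cast Fintype.card_pos
  have h0 : 0 ≤ (Fintype.card Λ : ℝ)⁻¹ * ∑ b, f b :=
    mul_nonneg (by positivity) (Finset.sum_nonneg fun b _ => hf0 b)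
  have h1 : (Fintype.card Λ : ℝ)⁻¹ * ∑ b, f b ≤ 1 := by
    rw [inv_mul_le_one₀ hQ]
    refine (Finset.sum_le_sum fun b _ => hf1 b).trans ?_
    simp
  rw [abs_le]
  constructor <;> linarith [hf0 a, hf1 a]

lemma sum_sub_mean (f : Λ → ℝ) [Nonempty Λ] :
    ∑ a, (f a - (Fintype.card Λ : ℝ)⁻¹ * ∑ b, f b) = 0 := by
  have hQ : (0 : ℝ) < Fintype.card Λ := by exact_mod_cast Fintype.card_pos
  rw [Finset.sum_sub_distrib, Finset.sum_const, Finset.card_univ, nsmul_eq_mul]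
  field_simp
  ring

/-- Concentration when many labels are expected to occur at least `k` times. -/
lemma weightedProb_meanUMean_le_of_frequent [Nonempty Λ]
    (hv : ∀ a b, 0 ≤ v a b) (hv1 : ∀ a, ∑ b, v a b = 1)
    (hR : ∀ b, |R b| ≤ 1) (hμ : ∀ a, ∑ b, v a b * R b = μ a) (hμ0 : ∀ a, 0 ≤ μ a)
    (hμ1 : ∀ a, μ a ≤ 1) {p t : ℝ} (ht0 : 0 < t) (ht1 : t ≤ 1)
    (hp : ∀ a, weightedProb (fun (_ : Fin n) (_ : Λ) => (Fintype.card Λ : ℝ)⁻¹)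
      (fun L => k ≤ labelCount L a) = p) :
    weightedProb (fun _ z => (Fintype.card Λ : ℝ)⁻¹ * v z.1 z.2) (fun x : Fin n → Λ × β =>
        2 * t < |meanUMean k (fun i => (x i).1) (fun i => R (x i).2)
          - (Fintype.card Λ : ℝ)⁻¹ * ∑ a, μ a ^ k|)
      ≤ 5 * Real.exp (-(p * Fintype.card Λ * t ^ 2 / 256)) := by
  classical
  set Q : ℝ := (Fintype.card Λ : ℝ) with hQdef
  have hQ : 0 < Q := by rw [hQdef]; exact_mod_cast Fintype.card_pos
  set u : Λ → ℝ := fun _ => Q⁻¹ with hu_def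
  have hu : ∀ a, 0 ≤ u a := fun a => by positivity
  have hu1 : ∑ a, u a = 1 := by
    simp only [hu_def, Finset.sum_const, Finset.card_univ, nsmul_eq_mul]
    exact mul_inv_cancel₀ hQ.ne'
  have hp0 : 0 ≤ p := hp (Classical.arbitrary Λ) ▸ weightedProb_nonneg (fun _ => hu) _
  -- For `p = 0` the bound is `5`, hence trivial; `p > 0` is needed to make the set of frequent
  -- labels nonempty.
  rcases hp0.eq_or_lt with hpz | hpp
  · rw [← hpz, zero_mul, zero_mul, zero_div, neg_zero, Real.exp_zero]
    refine (weightedProb_le_one (w := fun _ : Fin n => fun z : Λ × β => Q⁻¹ * v z.1 z.2)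
      (fun _ z => mul_nonneg (hu z.1) (hv _ _)) (fun _ => ?_) _).trans (by norm_num)
    rw [Fintype.sum_prod_type]
    simp only [← Finset.mul_sum, hv1, mul_one]
    exact hu1
  set F := Q⁻¹ * ∑ a, μ a ^ k with hF
  set c : Λ → ℝ := fun a => μ a ^ k - F with hc
  have hc1 : ∀ a, |c a| ≤ 1 := abs_sub_mean_le_one (fun a => pow_nonneg (hμ0 a) k)
    fun a => pow_le_one₀ (hμ0 a) (hμ1 a)
  have hc0 : ∑ a, c a = 0 := sum_sub_mean _
  have hJ : (∀ a b : ℕ, a ≤ b → k ≤ a → k ≤ b) ∨ (∀ a b : ℕ, a ≤ b → k ≤ b → k ≤ a) :=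
    Or.inl fun a b h1 h2 => h2.trans h1
  set m : (Fin n → Λ) → ℝ := fun L => (frequentLabels k L).card with hm
  have hexp : ∀ z, z ≤ -(p * Q * t ^ 2 / 256) →
      Real.exp z ≤ Real.exp (-(p * Q * t ^ 2 / 256)) := fun z hz => Real.exp_le_exp.mpr hz
  have ht2 : t ^ 2 ≤ 1 := pow_le_one₀ ht0.le ht1
  have hpQ : 0 < p * Q := mul_pos hpp hQ
  -- the number of frequent labels
  have hA1 : weightedProb (fun _ : Fin n => u) (fun L => m L < Q * p / 2)
      ≤ Real.exp (-(p * Q * t ^ 2 / 256)) := by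
    have h1 := weightedProb_le_of_le_exp (w := fun _ : Fin n => u) (fun _ => hu)
      (A := fun L => m L < Q * p / 2) (f := fun L => ∑ a, (-1 : ℝ) *
        if k ≤ labelCount L a then 1 else 0) (u := -(Q * p / 2)) fun L hL => by
          rw [← sum_frequentLabels]
          simp only [Finset.sum_neg_distrib, Finset.sum_const, nsmul_eq_mul, mul_one, hm] at hL ⊢
          linarith
    -- Tilting by `-1` gives the exponent `pQ/2 + pQ(exp(-1) - 1) ≤ -pQ/10`.
    have h2 := weightedMean_exp_sum_le (n := n) hu hu1 hJ hp (c := fun _ => -1)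
      (Or.inr fun _ => by norm_num)
    have h3 := h1.trans (mul_le_mul_of_nonneg_left h2
      (Real.exp_pos _).le)
    rw [← Real.exp_add] at h3
    refine h3.trans (hexp _ ?_)
    have h4 : Real.exp (-1) ≤ 0.4 := by
      have := Real.exp_neg_one_lt_d9
      linarith
    rw [Finset.sum_const, Finset.card_univ, nsmul_eq_mul, ← hQdef]
    have h5 := mul_le_mul_of_nonneg_left h4 hpQ.le
    have h6 := mul_le_mul_of_nonneg_left ht2 hpQ.le
    linarith
  -- the bias of the set of frequent labels
  have hA2 : weightedProb (fun _ : Fin n => u) (fun L =>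
      Q * p / 2 * t ≤ |∑ ℓ ∈ frequentLabels k L, c ℓ|)
      ≤ 2 * Real.exp (-(p * Q * t ^ 2 / 256)) := by
    have key : ∀ s : ℝ, |s| = t / 64 → weightedMean (fun _ : Fin n => u) (fun L =>
        Real.exp (s * ∑ ℓ ∈ frequentLabels k L, c ℓ)) ≤ Real.exp (p * Q * t ^ 2 / 256) := by
      intro s hs
      have h1 := weightedMean_exp_centred_le (n := n) hu hu1 hJ hp hc1 hc0 s
      simp only [sum_frequentLabels]
      refine h1.trans (Real.exp_le_exp.mpr ?_)
      rw [← sq_abs s, hs, ← hQdef]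
      have h2 : Real.exp (2 * (t / 64)) ≤ 3 := by
        refine (Real.exp_le_exp.mpr (by linarith : 2 * (t / 64) ≤ 1)).trans ?_
        have := Real.exp_one_lt_d9
        linarith
      have h3 := mul_le_mul_of_nonneg_left h2 (by positivity : 0 ≤ p * Q * t ^ 2)
      linarith [(by positivity : 0 ≤ p * Q * t ^ 2)]
    -- With `s = t/64` the gain `s * (pQt/2) = pQt²/128` is twice the exponent in `key`.
    have h1 := weightedProb_abs_le (w := fun _ : Fin n => u) (fun _ => hu)
      (A := fun L => Q * p / 2 * t ≤ |∑ ℓ ∈ frequentLabels k L, c ℓ|) (s := t / 64)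
      (by positivity) (fun L hL => hL) (key _ (abs_of_pos (by positivity)))
      (key _ (by rw [abs_neg]; exact abs_of_pos (by positivity)))
    refine h1.trans (le_of_eq ?_)
    rw [← Real.exp_add]
    congr 2
    ring
  have hA := weightedProb_or_le (w := fun _ : Fin n => u) (fun _ => hu)
    (fun L => m L < Q * p / 2) (fun L => Q * p / 2 * t ≤ |∑ ℓ ∈ frequentLabels k L, c ℓ|)
  have hmain := weightedProb_meanUMean_le (n := n) (k := k) (R := R) (μ := μ) (F := F) (t := t)
    hu hu1 hv hv1
    (η := 2 * Real.exp (-(p * Q * t ^ 2 / 256))) (by positivity)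
    (fun L => m L < Q * p / 2 ∨ Q * p / 2 * t ≤ |∑ ℓ ∈ frequentLabels k L, c ℓ|) ?_ ?_ ?_
  · linarith
  · intro L hL
    push Not at hL
    have : (0 : ℝ) < (frequentLabels k L).card := lt_of_lt_of_le (by positivity) hL.1
    exact Finset.card_pos.mp (by exact_mod_cast this)
  · intro L hL
    push Not at hL
    exact hL.2.le.trans (mul_le_mul_of_nonneg_right hL.1 ht0.le)
  · intro L hL
    push Not at hL
    have h1 := weightedProb_abs_sum_uMean_sub_le (k := k) hv hv1 hR hμ
      (fun a => by rw [abs_of_nonneg (hμ0 a)]; exact hμ1 a) L (V := fun _ => 1)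
      (fun ℓ hℓ => weightedMean_uMean_sub_sq_le_one (fun t => hv (L t)) (fun t => hv1 (L t)) hR
        (fun t ht => by rw [(Finset.mem_filter.mp ht).2]; exact hμ ℓ)
        (Finset.mem_filter.mp hℓ).2) (s := t / 16) (y := (frequentLabels k L).card * t)
      (by positivity)
    refine h1.trans (mul_le_mul_of_nonneg_left (hexp _ ?_) (by norm_num))
    -- With `m` frequent labels and `s = t/16`, the exponent is at most `3mt²/256 - mt²/16`, and `m
    -- ≥ pQ/2`.
    have h2 : Real.exp (2 * (t / 16)) ≤ 3 := by
      refine (Real.exp_le_exp.mpr (by linarith : 2 * (t / 16) ≤ 1)).trans ?_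
      have := Real.exp_one_lt_d9
      linarith
    rw [Finset.sum_const, nsmul_eq_mul, mul_one]
    have hm0 : (0 : ℝ) ≤ (frequentLabels k L).card := by positivity
    have h3 := mul_le_mul_of_nonneg_left h2
      (by positivity : 0 ≤ t ^ 2 * ((frequentLabels k L).card : ℝ))
    have h4 := mul_le_mul_of_nonneg_left hL.1 (sq_nonneg t)
    simp only [hm] at h4
    nlinarith
/-- Concentration when almost all labels are expected to occur at least `k * r` times. -/
lemma weightedProb_meanUMean_le_of_rare [Nonempty Λ]
    (hv : ∀ a b, 0 ≤ v a b) (hv1 : ∀ a, ∑ b, v a b = 1)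
    (hR : ∀ b, |R b| ≤ 1) (hμ : ∀ a, ∑ b, v a b * R b = μ a) (hμ0 : ∀ a, 0 ≤ μ a)
    (hμ1 : ∀ a, μ a ≤ 1) (hk : 1 ≤ k) {r : ℕ} (hr : 2 ≤ r) {p s₀ A t : ℝ} (ht0 : 0 < t)
    (ht1 : t ≤ 1) (hs₀ : 0 ≤ s₀) (hA : 0 < A)
    (hp : ∀ a, weightedProb (fun (_ : Fin n) (_ : Λ) => (Fintype.card Λ : ℝ)⁻¹)
      (fun L => labelCount L a < k * r) = p)
    (hp1 : p * Real.exp s₀ ≤ 1) (hp2 : 8 * A * Real.exp (2 * A) * p ≤ 1)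
    (hrA : 8 * k * A * Real.exp (2 * A) ≤ r) :
    weightedProb (fun _ z => (Fintype.card Λ : ℝ)⁻¹ * v z.1 z.2) (fun x : Fin n → Λ × β =>
        2 * t < |meanUMean k (fun i => (x i).1) (fun i => R (x i).2)
          - (Fintype.card Λ : ℝ)⁻¹ * ∑ a, μ a ^ k|)
      ≤ Real.exp (Fintype.card Λ * (1 - s₀ / r))
        + 4 * Real.exp (-(A * Fintype.card Λ * t ^ 2 / 4)) := by
  classical
  set Q : ℝ := (Fintype.card Λ : ℝ) with hQdef
  have hQ : 0 < Q := by rw [hQdef]; exact_mod_cast Fintype.card_pos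
  set u : Λ → ℝ := fun _ => Q⁻¹ with hu_def
  have hu : ∀ a, 0 ≤ u a := fun a => by positivity
  have hu1 : ∑ a, u a = 1 := by
    simp only [hu_def, Finset.sum_const, Finset.card_univ, nsmul_eq_mul]
    exact mul_inv_cancel₀ hQ.ne'
  have hp0 : 0 ≤ p := hp (Classical.arbitrary Λ) ▸ weightedProb_nonneg (fun _ => hu) _
  have hr0 : (0 : ℝ) < r := by exact_mod_cast (by omega : 0 < r)
  have hr2 : (2 : ℝ) ≤ r := by exact_mod_cast hr
  set F := Q⁻¹ * ∑ a, μ a ^ k with hF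
  set c : Λ → ℝ := fun a => μ a ^ k - F with hc
  have hc1 : ∀ a, |c a| ≤ 1 := abs_sub_mean_le_one (fun a => pow_nonneg (hμ0 a) k)
    fun a => pow_le_one₀ (hμ0 a) (hμ1 a)
  have hc0 : ∑ a, c a = 0 := sum_sub_mean _
  set D : (Fin n → Λ) → ℝ := fun L => ∑ a, if labelCount L a < k * r then 1 else 0 with hD
  have hbound : ∀ z, z ≤ -(A * Q * t ^ 2 / 4) →
      Real.exp z ≤ Real.exp (-(A * Q * t ^ 2 / 4)) := fun z hz => Real.exp_le_exp.mpr hz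
  -- the number of rare labels
  have hA1 : weightedProb (fun _ : Fin n => u) (fun L => Q / r < D L)
      ≤ Real.exp (Q * (1 - s₀ / r)) := by
    have hJ : (∀ a b : ℕ, a ≤ b → a < k * r → b < k * r) ∨
        (∀ a b : ℕ, a ≤ b → b < k * r → a < k * r) := Or.inr fun a b h1 h2 => h1.trans_lt h2
    have h1 := weightedProb_le_of_le_exp (w := fun _ : Fin n => u) (fun _ => hu)
      (A := fun L => Q / r < D L) (f := fun L => ∑ a, s₀ *
        if labelCount L a < k * r then 1 else 0) (u := s₀ * (Q / r)) fun L hL => by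
          rw [← Finset.mul_sum]
          exact mul_le_mul_of_nonneg_left hL.le hs₀
    have h2 := weightedMean_exp_sum_le (n := n) hu hu1 hJ hp (c := fun _ => s₀)
      (Or.inl fun _ => hs₀)
    have h3 := h1.trans (mul_le_mul_of_nonneg_left h2
      (Real.exp_pos _).le)
    rw [← Real.exp_add] at h3
    refine h3.trans (Real.exp_le_exp.mpr ?_)
    rw [Finset.sum_const, Finset.card_univ, nsmul_eq_mul, ← hQdef]
    -- Rareness is unlikely enough to absorb the large tilt: `p (exp s₀ - 1) ≤ 1`, against a gain of
    -- `s₀ Q / r`.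
    have h4 := mul_le_mul_of_nonneg_left hp1 hQ.le
    have h5 := mul_nonneg hp0 hQ.le
    have h6 : s₀ * (Q / r) = Q * (s₀ / r) := by ring
    linarith
  -- the bias of the set of frequent labels
  have hA2 : weightedProb (fun _ : Fin n => u) (fun L =>
      Q / 2 * t ≤ |∑ ℓ ∈ frequentLabels k L, c ℓ|)
      ≤ 2 * Real.exp (-(A * Q * t ^ 2 / 4)) := by
    have hJ : (∀ a b : ℕ, a ≤ b → a < k → b < k) ∨
        (∀ a b : ℕ, a ≤ b → b < k → a < k) := Or.inr fun a b h1 h2 => h1.trans_lt h2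
    set p' := weightedProb (fun _ : Fin n => u) (fun L => labelCount L (Classical.arbitrary Λ) < k)
      with hp'
    have hp'p : p' ≤ p := by
      rw [← hp (Classical.arbitrary Λ)]
      exact weightedProb_mono (fun _ => hu) fun L hL =>
        lt_of_lt_of_le hL (Nat.le_mul_of_pos_right k (by omega))
    -- Since `c` sums to zero, the bias can be read off the few labels with fewer than `k` samples.
    -- Their small probability `p'` replaces a probability near `1` in the exponential moment and
    -- permits the large tilt `A * t`.
    have hsum : ∀ L : Fin n → Λ, ∑ ℓ ∈ frequentLabels k L, c ℓ
        = -∑ a, c a * if labelCount L a < k then 1 else 0 := by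
      intro L
      have h1 : ∑ a, c a * (if labelCount L a < k then 1 else 0)
          = ∑ a, c a - ∑ a, c a * (if k ≤ labelCount L a then 1 else 0) := by
        rw [← Finset.sum_sub_distrib]
        refine Finset.sum_congr rfl fun a _ => ?_
        rcases lt_or_ge (labelCount L a) k with h | h
        · simp [h, not_le.mpr h]
        · simp [h, not_lt.mpr h]
      rw [h1, hc0, sum_frequentLabels]
      ring
    have key : ∀ s : ℝ, |s| = A * t → weightedMean (fun _ : Fin n => u) (fun L =>
        Real.exp (s * ∑ a, c a * if labelCount L a < k then 1 else 0))
          ≤ Real.exp (A * Q * t ^ 2 / 4) := by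
      intro s hs
      have h1 := weightedMean_exp_centred_le (n := n) hu hu1 hJ
        (fun a => weightedProb_labelCount_swap _ (fun T => T < k) a (Classical.arbitrary Λ))
        hc1 hc0 s
      refine h1.trans (Real.exp_le_exp.mpr ?_)
      rw [← sq_abs s, hs, ← hQdef, ← hp']
      have h2 : Real.exp (2 * (A * t)) ≤ Real.exp (2 * A) :=
        Real.exp_le_exp.mpr (by nlinarith)
      have h3 : 8 * A * (Real.exp (2 * (A * t)) * p') ≤ 1 := by
        refine le_trans ?_ hp2
        rw [mul_assoc (8 * A)]
        refine mul_le_mul_of_nonneg_left ?_ (by positivity)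
        exact mul_le_mul h2 hp'p (weightedProb_nonneg (fun _ => hu) _) (Real.exp_pos _).le
      have h4 := mul_le_mul_of_nonneg_left h3 (by positivity : 0 ≤ A * Q * t ^ 2 / 4)
      refine le_trans (le_of_eq ?_) (h4.trans (le_of_eq (mul_one _)))
      ring
    have h1 := weightedProb_abs_le (w := fun _ : Fin n => u) (fun _ => hu)
      (A := fun L => Q / 2 * t ≤ |∑ ℓ ∈ frequentLabels k L, c ℓ|) (s := A * t)
      (f := fun L => ∑ a, c a * if labelCount L a < k then 1 else 0)
      (by positivity) (fun L hL => by rwa [hsum, abs_neg] at hL)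
      (key _ (abs_of_pos (by positivity)))
      (key _ (by rw [abs_neg]; exact abs_of_pos (by positivity)))
    refine h1.trans (le_of_eq ?_)
    rw [← Real.exp_add]
    congr 2
    ring
  have hA := weightedProb_or_le (w := fun _ : Fin n => u) (fun _ => hu)
    (fun L => Q / r < D L) (fun L => Q / 2 * t ≤ |∑ ℓ ∈ frequentLabels k L, c ℓ|)
  have hcard : ∀ L : Fin n → Λ, D L ≤ Q / r → Q / 2 ≤ (frequentLabels k L).card := by
    intro L hL
    have h1 : Q ≤ (frequentLabels k L).card + D L := by
      have h2 : ((frequentLabels k L).card : ℝ) = ∑ a, if k ≤ labelCount L a then (1 : ℝ) else 0 := by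
        rw [frequentLabels, Finset.sum_boole]
      rw [h2, hD, ← Finset.sum_add_distrib, hQdef, ← Finset.card_univ, ← nsmul_one,
        ← Finset.sum_const]
      refine Finset.sum_le_sum fun a _ => ?_
      rcases lt_or_ge (labelCount L a) k with h | h
      · have : labelCount L a < k * r := lt_of_lt_of_le h (Nat.le_mul_of_pos_right k (by omega))
        simp [this, not_le.mpr h]
      · rw [if_pos h]; split_ifs <;> norm_num
    have h3 : Q / r ≤ Q / 2 := div_le_div_of_nonneg_left hQ.le (by norm_num) hr2
    linarith
  have hmain := weightedProb_meanUMean_le (n := n) (k := k) (R := R) (μ := μ) (F := F) (t := t)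
    hu hu1 hv hv1
    (η := 2 * Real.exp (-(A * Q * t ^ 2 / 4))) (by positivity)
    (fun L => Q / r < D L ∨ Q / 2 * t ≤ |∑ ℓ ∈ frequentLabels k L, c ℓ|) ?_ ?_ ?_
  · linarith
  · intro L hL
    push Not at hL
    have : (0 : ℝ) < (frequentLabels k L).card := lt_of_lt_of_le (by positivity) (hcard L hL.1)
    exact Finset.card_pos.mp (by exact_mod_cast this)
  · intro L hL
    push Not at hL
    exact hL.2.le.trans (mul_le_mul_of_nonneg_right (hcard L hL.1) ht0.le)
  · intro L hL
    push Not at hL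
    have hμS : ∀ ℓ, ∀ t ∈ labelFiber L ℓ, ∑ b, v (L t) b * R b = μ ℓ := fun ℓ t ht => by
      rw [(Finset.mem_filter.mp ht).2]; exact hμ ℓ
    -- Labels below `k * r` samples get the trivial variance bound `1`, the others `k² / (k r) = k /
    -- r`. As there are at most `Q / r` of the former, the total is at most `2kQ / r`.
    have h1 := weightedProb_abs_sum_uMean_sub_le (k := k) hv hv1 hR hμ
      (fun a => by rw [abs_of_nonneg (hμ0 a)]; exact hμ1 a) L
      (V := fun ℓ => (if labelCount L ℓ < k * r then 1 else 0) + k / r)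
      (fun ℓ hℓ => by
        have hkT : k ≤ (labelFiber L ℓ).card := (Finset.mem_filter.mp hℓ).2
        split_ifs with h
        · refine (weightedMean_uMean_sub_sq_le_one (fun t => hv (L t)) (fun t => hv1 (L t)) hR
            (hμS ℓ) hkT).trans ?_
          have : (0 : ℝ) ≤ k / r := by positivity
          linarith
        · refine (weightedMean_uMean_sub_sq_le (fun t => hv (L t)) (fun t => hv1 (L t)) hR
            (hμS ℓ) hk hkT).trans ?_
          rw [zero_add]
          have h2 : ((k * r : ℕ) : ℝ) ≤ (labelFiber L ℓ).card := by exact_mod_cast not_lt.mp h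
          push_cast at h2
          have hk0 : (0 : ℝ) < k := by exact_mod_cast hk
          rw [div_le_div_iff₀ (by nlinarith) hr0]
          nlinarith) (s := A * t) (y := (frequentLabels k L).card * t)
      (by positivity)
    refine h1.trans (mul_le_mul_of_nonneg_left (hbound _ ?_) (by norm_num))
    have hk1 : (1 : ℝ) ≤ k := by exact_mod_cast hk
    have h2 : ∑ ℓ ∈ frequentLabels k L, ((if labelCount L ℓ < k * r then (1 : ℝ) else 0) + k / r)
        ≤ 2 * k * Q / r := by
      calc _ ≤ ∑ ℓ, ((if labelCount L ℓ < k * r then (1 : ℝ) else 0) + k / r) :=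
            Finset.sum_le_sum_of_subset_of_nonneg (Finset.subset_univ _) fun ℓ _ _ => by
              split_ifs <;> positivity
        _ = D L + Q * (k / r) := by
            rw [Finset.sum_add_distrib, Finset.sum_const, Finset.card_univ, nsmul_eq_mul]
        _ ≤ Q / r + Q * (k / r) := by linarith [hL.1]
        _ = (1 + k) * (Q / r) := by ring
        _ ≤ (2 * k) * (Q / r) := mul_le_mul_of_nonneg_right (by linarith) (by positivity)
        _ = _ := by ring
    have h3 : Real.exp (2 * (A * t)) ≤ Real.exp (2 * A) :=
      Real.exp_le_exp.mpr (by nlinarith)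
    have h4 : Real.exp (2 * (A * t)) * ∑ ℓ ∈ frequentLabels k L,
        ((if labelCount L ℓ < k * r then (1 : ℝ) else 0) + k / r)
        ≤ Real.exp (2 * A) * (2 * k * Q / r) :=
      mul_le_mul h3 h2 (Finset.sum_nonneg fun ℓ _ => by split_ifs <;> positivity)
        (Real.exp_pos _).le
    have h5 : A * (Real.exp (2 * A) * (2 * k * Q / r)) ≤ Q / 4 := by
      have h6 := mul_le_mul_of_nonneg_right hrA (by positivity : 0 ≤ Q / (4 * r))
      have h7 : (r : ℝ) * (Q / (4 * r)) = Q / 4 := by field_simp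
      rw [h7] at h6
      refine le_trans (le_of_eq ?_) h6
      field_simp
      ring
    have h6 := mul_le_mul_of_nonneg_left h4 (by positivity : 0 ≤ A ^ 2 * t ^ 2)
    have h7 := mul_le_mul_of_nonneg_left h5 (by positivity : 0 ≤ A * t ^ 2)
    have h8 := mul_le_mul_of_nonneg_right (hcard L hL.1) (by positivity : 0 ≤ A * t ^ 2)
    rw [mul_pow]
    nlinarith

end UniformTail

/-! ### Choice of constants and the sample complexity for one pair -/

section Complexity

lemma weightedProb_add_compl {ι α : Type*} [Fintype ι] [DecidableEq ι] [Fintype α]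
    {w : ι → α → ℝ} (hw1 : ∀ i, ∑ a, w i a = 1) {A B : (ι → α) → Prop}
    (hAB : ∀ x, A x ↔ ¬ B x) : weightedProb w A + weightedProb w B = 1 := by
  classical
  rw [weightedProb, weightedProb, ← weightedMean_add]
  refine Eq.trans (congrArg _ ?_) (weightedMean_const hw1 1)
  funext x
  by_cases hB : B x <;> simp [hAB, hB]

lemma half_pow_le_choose_mul_factorial {n k : ℕ} (hn : 2 * k ≤ n) :
    ((n : ℝ) / 2) ^ k ≤ n.choose k * k ! := by
  have h1 : (n + 1 - k) ^ k ≤ n.choose k * k ! := by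
    have := Nat.pow_sub_le_descFactorial n k
    rwa [Nat.descFactorial_eq_factorial_mul_choose, mul_comm] at this
  have h2 : (n : ℝ) / 2 ≤ ((n + 1 - k : ℕ) : ℝ) := by
    rw [Nat.cast_sub (by omega)]
    have : (2 : ℝ) * k ≤ n := by exact_mod_cast hn
    push_cast
    linarith
  exact (pow_le_pow_left₀ (by positivity) h2 k).trans (by exact_mod_cast h1)

lemma exp_neg_two_mul_le {q : ℝ} (h0 : 0 ≤ q) (h1 : q ≤ 1 / 2) : Real.exp (-(2 * q)) ≤ 1 - q := by
  rw [Real.exp_neg, inv_le_comm₀ (Real.exp_pos _) (by linarith), inv_le_iff_one_le_mul₀ (by linarith)]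
  have := Real.add_one_le_exp (2 * q)
  nlinarith

variable {Λ β : Type*} [Fintype Λ] [DecidableEq Λ] [Fintype β] {n k : ℕ}

lemma sum_card_inv [Nonempty Λ] : ∑ _a : Λ, (Fintype.card Λ : ℝ)⁻¹ = 1 := by
  have hQ : (0 : ℝ) < Fintype.card Λ := by exact_mod_cast Fintype.card_pos
  rw [Finset.sum_const, Finset.card_univ, nsmul_eq_mul]
  exact mul_inv_cancel₀ hQ.ne'

/-- A lower bound for the probability that a label occurs at least `k` times. -/
lemma le_weightedProb_frequent [Nonempty Λ] (hk : 1 ≤ k) (hn : 2 * k ≤ n) {K C a : ℝ}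
    (hK : 0 < K) (hC : 2 * Real.exp 16 * (K + 1) ≤ C) (ha : 0 ≤ a)
    (hCa : C * a * Fintype.card Λ ≤ n) (hKa : K * a ^ k / k ! ≤ 1 / 2) (ℓ : Λ) :
    K * a ^ k / k ! ≤ weightedProb (fun (_ : Fin n) (_ : Λ) => (Fintype.card Λ : ℝ)⁻¹)
      (fun L => k ≤ labelCount L ℓ) := by
  set Q : ℝ := (Fintype.card Λ : ℝ) with hQdef
  have hQ : 0 < Q := by rw [hQdef]; exact_mod_cast Fintype.card_pos
  have hu : ∀ _ : Λ, 0 ≤ Q⁻¹ := fun _ => by positivity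
  have hu1 : ∑ _a : Λ, Q⁻¹ = 1 := sum_card_inv
  have hk1 : (1 : ℝ) ≤ k := by exact_mod_cast hk
  have hcompl := weightedProb_add_compl (w := fun (_ : Fin n) (_ : Λ) => Q⁻¹) (fun _ => hu1)
    (A := fun L => k ≤ labelCount L ℓ) (B := fun L => (labelCount L ℓ : ℝ) < k)
    fun L => by rw [Nat.cast_lt, not_lt]
  have hnQ : C * a ≤ n * Q⁻¹ := by rwa [← div_eq_mul_inv, le_div_iff₀ hQ]
  -- If the expected count is at least `8k`, a Chernoff bound gives probability at least `1/2`.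
  -- Otherwise the binomial term for exactly `k` samples suffices, because its factor `(1 -
  -- 1/Q)^(n-k)` is at least `exp(-2n/Q) ≥ exp(-16k)`; this needs `Q ≥ 2`, so a single label is
  -- treated separately.
  rcases le_or_gt (8 * (k : ℝ)) (n * Q⁻¹) with h | h
  · have h1 := weightedProb_labelCount_lt_le (n := n) hu hu1 ℓ (k : ℝ)
    have h2 : Real.exp (k - n * Q⁻¹ / 2) ≤ 1 / 2 := by
      refine (Real.exp_le_exp.mpr (by linarith : _ ≤ (-1 : ℝ))).trans ?_
      have := Real.exp_neg_one_lt_d9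
      linarith
    linarith
  · rcases le_or_gt (Fintype.card Λ) 1 with hc | hc
    · have hs : Subsingleton Λ := Fintype.card_le_one_iff_subsingleton.mp hc
      have h1 : weightedProb (fun (_ : Fin n) (_ : Λ) => Q⁻¹)
          (fun L => (labelCount L ℓ : ℝ) < k) = 0 := by
        have : ∀ L : Fin n → Λ, ¬ (labelCount L ℓ : ℝ) < k := fun L => by
          rw [Nat.cast_lt, not_lt, labelCount, Finset.filter_true_of_mem fun t _ =>
            Subsingleton.elim _ _, Finset.card_univ, Fintype.card_fin]
          omega
        simp [weightedProb, weightedMean, this]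
      linarith
    · refine le_trans ?_ (le_weightedProb_le_labelCount hu hu1 ℓ k)
      have hQ2 : (2 : ℝ) ≤ Q := by rw [hQdef]; exact_mod_cast hc
      have hq : Q⁻¹ ≤ 1 / 2 := by rw [inv_le_comm₀ hQ (by norm_num)]; norm_num; exact hQ2
      have hq0 : 0 < Q⁻¹ := by positivity
      have h1 := exp_neg_two_mul_le hq0.le hq
      have h2 : Real.exp (-16) ^ k ≤ (1 - Q⁻¹) ^ (n - k) := by
        refine le_trans ?_ (pow_le_pow_of_le_one (by linarith) (by linarith) (Nat.sub_le n k))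
        refine le_trans ?_ (pow_le_pow_left₀ (Real.exp_pos _).le h1 n)
        rw [← Real.exp_nat_mul, ← Real.exp_nat_mul]
        exact Real.exp_le_exp.mpr (by linarith)
      have h3 := half_pow_le_choose_mul_factorial hn
      have h4 : (K + 1) * a ≤ n / 2 * Q⁻¹ * Real.exp (-16) := by
        have h5 : Real.exp 16 * Real.exp (-16) = 1 := by rw [← Real.exp_add]; simp
        have h6 := mul_le_mul_of_nonneg_right
          ((mul_le_mul_of_nonneg_right hC ha).trans hnQ) (Real.exp_pos (-16)).le
        have h7 : 2 * Real.exp 16 * (K + 1) * a * Real.exp (-16)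
            = 2 * ((K + 1) * a) := by linear_combination 2 * (K + 1) * a * h5
        linarith
      have h5 := pow_le_pow_left₀ (by positivity) h4 k
      -- Using `K + 1 ≥ 1` makes the constant independent of `k`: its `k`-th power still dominates
      -- `K`.
      have h6 : K * a ^ k ≤ ((K + 1) * a) ^ k := by
        rw [mul_pow]
        refine mul_le_mul_of_nonneg_right ?_ (by positivity)
        exact (by linarith : K ≤ K + 1).trans (le_self_pow₀ (by linarith) (by omega))
      rw [div_le_iff₀ (by positivity)]
      refine (h6.trans h5).trans ?_
      rw [mul_pow, mul_pow]
      calc ((n : ℝ) / 2) ^ k * Q⁻¹ ^ k * Real.exp (-16) ^ k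
          ≤ (n.choose k * k !) * Q⁻¹ ^ k * (1 - Q⁻¹) ^ (n - k) := by
            refine mul_le_mul (mul_le_mul_of_nonneg_right h3 (by positivity)) h2 (by positivity)
              (by positivity)
        _ = _ := by ring

/-- The factor `1 + 3/L₀` yields an extra `exp(-3)`, which absorbs the prefactor `5` and the
division by three in the union bound. A positive lower bound on `L` is essential here. -/
lemma five_mul_exp_le {L₀ L : ℝ} (hL₀ : 0 < L₀) (hL : L₀ ≤ L) :
    5 * Real.exp (-((1 + 3 / L₀) * L)) ≤ Real.exp (-L) / 3 := by
  have h1 : 3 ≤ 3 / L₀ * L := by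
    rw [div_mul_eq_mul_div, le_div_iff₀ hL₀]; linarith
  have h2 : Real.exp (-((1 + 3 / L₀) * L)) ≤ Real.exp (-L) * Real.exp (-3) := by
    rw [← Real.exp_add]; exact Real.exp_le_exp.mpr (by linarith)
  have h3 : Real.exp (-3) ≤ 1 / 15 := by
    have h4 : Real.exp (-3) = Real.exp (-1) ^ 3 := by rw [← Real.exp_nat_mul]; norm_num
    have h5 : Real.exp (-1) ≤ 0.37 := by linarith [Real.exp_neg_one_lt_d9]
    rw [h4]
    exact (pow_le_pow_left₀ (Real.exp_pos _).le h5 3).trans (by norm_num)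
  nlinarith [Real.exp_pos (-L)]

/-- The sample complexity of estimating the mean of `μ ℓ ^ k` over the labels. -/
theorem exists_sample_complexity {L₀ : ℝ} (hL₀ : 0 < L₀) :
    ∃ C : ℝ, 0 < C ∧ ∀ {Λ β : Type} [Fintype Λ] [DecidableEq Λ] [Fintype β] [Nonempty Λ]
      {n k : ℕ} {v : Λ → β → ℝ} {R : β → ℝ} {μ : Λ → ℝ} {t a L : ℝ},
      (∀ a b, 0 ≤ v a b) → (∀ a, ∑ b, v a b = 1) → (∀ b, |R b| ≤ 1) →
      (∀ a, ∑ b, v a b * R b = μ a) → (∀ a, 0 ≤ μ a) → (∀ a, μ a ≤ 1) →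
      1 ≤ k → 0 < t → t ≤ 1 → L₀ ≤ L → 0 ≤ a → a ≤ 1 →
      a ^ k * Fintype.card Λ * (64 * t ^ 2) = k ! * L → C * a * Fintype.card Λ ≤ n →
      weightedProb (fun _ z => (Fintype.card Λ : ℝ)⁻¹ * v z.1 z.2) (fun x : Fin n → Λ × β =>
        2 * t < |meanUMean k (fun i => (x i).1) (fun i => R (x i).2)
          - (Fintype.card Λ : ℝ)⁻¹ * ∑ a, μ a ^ k|) ≤ Real.exp (-L) / 3 := by
  -- Every exponent must reach `c₁ * L`. In the first regime `K = 64 * 256 * c₁` cancels the `64` in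
  -- `a^k Q (64 t²) = k! L` and the `256` of the tail bound. In the second, `L ≤ 64 Q t²` makes `A =
  -- 256 c₁` and `s₀ / r = 1 + 64 c₁` sufficient, and `B` makes `p ≤ exp(-B)` small enough for both
  -- tilts.
  obtain ⟨c₁, hc₁⟩ : ∃ y : ℝ, y = 1 + 3 / L₀ := ⟨_, rfl⟩
  have hc₁0 : 0 < c₁ := by rw [hc₁]; positivity
  obtain ⟨K, hK⟩ : ∃ y : ℝ, y = 16384 * c₁ := ⟨_, rfl⟩
  have hK0 : 0 < K := by rw [hK]; positivity
  obtain ⟨A, hA⟩ : ∃ y : ℝ, y = 256 * c₁ := ⟨_, rfl⟩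
  have hA0 : 0 < A := by rw [hA]; positivity
  obtain ⟨r, hr2, hr⟩ : ∃ r : ℕ, 2 ≤ r ∧ 8 * (2 * K) * A * Real.exp (2 * A) ≤ r := by
    obtain ⟨r, hr⟩ := exists_nat_ge (8 * (2 * K) * A * Real.exp (2 * A))
    exact ⟨r + 2, by omega, hr.trans (by push_cast; linarith)⟩
  have hr0 : (0 : ℝ) < r := by exact_mod_cast (by omega : 0 < r)
  obtain ⟨s₀, hs₀⟩ : ∃ y : ℝ, y = r * (1 + 64 * c₁) := ⟨_, rfl⟩
  have hs₀0 : 0 ≤ s₀ := by rw [hs₀]; positivity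
  obtain ⟨B, hB⟩ : ∃ y : ℝ, y = s₀ + 8 * A * Real.exp (2 * A) := ⟨_, rfl⟩
  have hB0 : 0 ≤ B := by rw [hB]; positivity
  -- The three demands on `C` serve the binomial lower bound, the inequality `2k ≤ n`, and the
  -- largeness of `n/Q` in the second regime.
  obtain ⟨C, hC1, hC2, hC3⟩ : ∃ C : ℝ, 2 * Real.exp 16 * (K + 1) ≤ C ∧ 128 / L₀ ≤ C ∧
      4 * K * (B + 2 * K * r) ≤ C := by
    refine ⟨2 * Real.exp 16 * (K + 1) + 128 / L₀ + 4 * K * (B + 2 * K * r), ?_, ?_, ?_⟩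
    · linarith [(by positivity : 0 ≤ 128 / L₀ + 4 * K * (B + 2 * K * r))]
    · linarith [(by positivity : 0 ≤ 2 * Real.exp 16 * (K + 1) + 4 * K * (B + 2 * K * r))]
    · linarith [(by positivity : 0 ≤ 2 * Real.exp 16 * (K + 1) + 128 / L₀)]
  have hC0 : 0 < C := lt_of_lt_of_le (by positivity) hC1
  refine ⟨C, hC0, ?_⟩
  intro Λ β _ _ _ _ n k v R μ t a L hv hv1 hR hμ hμ0 hμ1 hk ht0 ht1 hL ha0 ha1 hak hn
  set Q : ℝ := (Fintype.card Λ : ℝ) with hQdef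
  have hQ : 0 < Q := by rw [hQdef]; exact_mod_cast Fintype.card_pos
  have hL0 : 0 < L := hL₀.trans_le hL
  have ht2 : t ^ 2 ≤ 1 := pow_le_one₀ ht0.le ht1
  have hkf : (k : ℝ) ≤ k ! := by exact_mod_cast Nat.self_le_factorial k
  have hk1 : (1 : ℝ) ≤ k := by exact_mod_cast hk
  have hk0 : (0 : ℝ) < k ! := by positivity
  have haka : a ^ k ≤ a := pow_le_of_le_one ha0 ha1 (by omega)
  have hak1 : a ^ k ≤ 1 := haka.trans ha1
  have hak0 : 0 ≤ a ^ k := by positivity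
  have hlow : k ! * L ≤ 64 * (a ^ k * Q) := by
    rw [← hak]
    linarith [mul_le_mul_of_nonneg_left ht2 (mul_nonneg hak0 hQ.le)]
  have hn2 : 2 * k ≤ n := by
    have h1 : (k : ℝ) * L₀ ≤ 64 * (a * Q) :=
      calc (k : ℝ) * L₀ ≤ k ! * L := mul_le_mul hkf hL hL₀.le hk0.le
        _ ≤ 64 * (a ^ k * Q) := hlow
        _ ≤ _ := by linarith [mul_le_mul_of_nonneg_right haka hQ.le]
    have h2 := mul_le_mul_of_nonneg_right hC2 (by positivity : 0 ≤ a * Q)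
    have h3 : 2 * (k : ℝ) ≤ 128 / L₀ * (a * Q) := by
      rw [div_mul_eq_mul_div, le_div_iff₀ hL₀]; linarith
    have h4 : 2 * (k : ℝ) ≤ n := by linarith
    exact_mod_cast h4
  rcases le_or_gt (K * a ^ k / k !) (1 / 2) with hcase | hcase
  · have hp := le_weightedProb_frequent hk hn2 hK0 hC1 ha0 hn hcase (Classical.arbitrary Λ)
    set p := weightedProb (fun (_ : Fin n) (_ : Λ) => (Fintype.card Λ : ℝ)⁻¹)
      (fun L => k ≤ labelCount L (Classical.arbitrary Λ)) with hpdef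
    have h1 := weightedProb_meanUMean_le_of_frequent (n := n) (k := k) hv hv1 hR hμ hμ0 hμ1 ht0 ht1
      (fun a => weightedProb_labelCount_swap _ (fun T => k ≤ T) a (Classical.arbitrary Λ))
    refine h1.trans (le_trans ?_ (hc₁ ▸ five_mul_exp_le hL₀ hL))
    refine mul_le_mul_of_nonneg_left (Real.exp_le_exp.mpr (neg_le_neg ?_)) (by norm_num)
    rw [← hQdef, ← hpdef]
    have h2 := mul_le_mul_of_nonneg_right hp (by positivity : 0 ≤ Q * t ^ 2 / 256)
    have h3 : K * a ^ k / k ! * (Q * t ^ 2 / 256) = c₁ * L := by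
      have h4 : K * a ^ k / k ! * (Q * t ^ 2 / 256)
          = c₁ * (a ^ k * Q * (64 * t ^ 2)) / k ! := by rw [hK]; ring
      rw [h4, hak]
      field_simp
    rw [h3] at h2
    linarith
  -- Here `k! < 2K a^k`. With `a ≤ 1` this bounds `k` by `2K` and `a` below by `1/(2K)`, so `n/Q` is
  -- at least `C/(2K)`.
  · rw [lt_div_iff₀ hk0] at hcase
    have hk2K : (k : ℝ) ≤ 2 * K := by linarith [mul_le_mul_of_nonneg_left hak1 hK0.le]
    have ha2K : 1 ≤ 2 * K * a := by linarith [mul_le_mul_of_nonneg_left haka hK0.le]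
    have hnQ : C ≤ 2 * K * (n * Q⁻¹) := by
      have h1 : C * a ≤ n * Q⁻¹ := by rwa [← div_eq_mul_inv, le_div_iff₀ hQ]
      have h2 := mul_le_mul_of_nonneg_left h1 (by positivity : 0 ≤ 2 * K)
      have h3 := mul_le_mul_of_nonneg_left ha2K hC0.le
      linarith
    have hu : ∀ _ : Λ, 0 ≤ Q⁻¹ := fun _ => by positivity
    have hu1 : ∑ _a : Λ, Q⁻¹ = 1 := sum_card_inv
    set p := weightedProb (fun (_ : Fin n) (_ : Λ) => (Fintype.card Λ : ℝ)⁻¹)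
      (fun L => labelCount L (Classical.arbitrary Λ) < k * r) with hpdef
    have hpB : p ≤ Real.exp (-B) := by
      have h1 := weightedProb_labelCount_lt_le (n := n) hu hu1 (Classical.arbitrary Λ)
        ((k * r : ℕ) : ℝ)
      simp only [Nat.cast_lt] at h1
      refine h1.trans (Real.exp_le_exp.mpr ?_)
      have h2 : B + 2 * K * r ≤ n * Q⁻¹ / 2 := by
        have h3 := hC3.trans hnQ
        have h4 : 4 * K * (B + 2 * K * r) ≤ 4 * K * (n * Q⁻¹ / 2) := by linarith
        exact le_of_mul_le_mul_left h4 (by positivity)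
      have h3 : ((k * r : ℕ) : ℝ) ≤ 2 * K * r := by
        push_cast
        exact mul_le_mul_of_nonneg_right hk2K hr0.le
      linarith
    have hE : Real.exp (-B) * Real.exp B = 1 := by rw [← Real.exp_add]; simp
    have h8 : 0 < 8 * A * Real.exp (2 * A) := by positivity
    have hp1 : p * Real.exp s₀ ≤ 1 := by
      rw [← hE]
      exact mul_le_mul hpB (Real.exp_le_exp.mpr (by linarith)) (Real.exp_pos _).le
        (Real.exp_pos _).le
    have hp2 : 8 * A * Real.exp (2 * A) * p ≤ 1 := by
      rw [← hE, mul_comm (Real.exp (-B))]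
      refine mul_le_mul ?_ hpB (weightedProb_nonneg (fun _ => hu) _) (Real.exp_pos _).le
      have := Real.add_one_le_exp B
      linarith
    have h1 := weightedProb_meanUMean_le_of_rare (n := n) (k := k) hv hv1 hR hμ hμ0 hμ1 hk hr2 ht0
      ht1 hs₀0 hA0
      (fun a => weightedProb_labelCount_swap _ (fun T => T < k * r) a (Classical.arbitrary Λ))
      hp1 hp2 (le_trans (by gcongr) hr)
    refine h1.trans (le_trans ?_ (hc₁ ▸ five_mul_exp_le hL₀ hL))
    rw [← hQdef]
    have hLQ : L ≤ 64 * (Q * t ^ 2) := by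
      have h2 : L ≤ k ! * L := le_mul_of_one_le_left hL0.le (hk1.trans hkf)
      rw [← hak] at h2
      linarith [mul_le_mul_of_nonneg_right hak1 (by positivity : 0 ≤ Q * (64 * t ^ 2))]
    have h2 : Real.exp (Q * (1 - s₀ / r)) ≤ Real.exp (-(c₁ * L)) := by
      refine Real.exp_le_exp.mpr ?_
      have h3 : s₀ / r = 1 + 64 * c₁ := by rw [hs₀]; field_simp
      have h4 : L ≤ 64 * Q := by linarith [mul_le_mul_of_nonneg_left ht2 hQ.le]
      rw [h3]
      linarith [mul_le_mul_of_nonneg_left h4 hc₁0.le]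
    have h3 : Real.exp (-(A * Q * t ^ 2 / 4)) ≤ Real.exp (-(c₁ * L)) := by
      refine Real.exp_le_exp.mpr ?_
      rw [hA]
      linarith [mul_le_mul_of_nonneg_left hLQ hc₁0.le]
    linarith

end Complexity

/-! ### The outcome probabilities of the SWAP test -/

section SwapTest

variable {d : ℕ}

/-- The operator exchanging the two registers. -/
def registerSwap (d : ℕ) : Matrix (Fin d × Fin d) (Fin d × Fin d) ℂ :=
  Matrix.of fun x y => if x = y.swap then 1 else 0

lemma registerSwap_mul_apply (X : Matrix (Fin d × Fin d) (Fin d × Fin d) ℂ) (x y) :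
    (registerSwap d * X) x y = X x.swap y := by
  simp only [Matrix.mul_apply, registerSwap, Matrix.of_apply, ite_mul, one_mul, zero_mul]
  rw [Finset.sum_eq_single x.swap]
  · simp
  · intro z _ hz
    rw [if_neg]
    rintro rfl
    simp at hz
  · simp

lemma registerSwap_conjTranspose : (registerSwap d)ᴴ = registerSwap d := by
  ext x y
  simp only [Matrix.conjTranspose_apply, registerSwap, Matrix.of_apply]
  have : y = x.swap ↔ x = y.swap := by
    constructor <;> rintro rfl <;> simp
  by_cases h : x = y.swap
  · simp [h]
  · rw [if_neg h, if_neg fun h' => h (this.mp h')]; simp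

lemma registerSwap_mul_self : registerSwap d * registerSwap d = 1 := by
  ext x y
  rw [registerSwap_mul_apply]
  simp [registerSwap, Matrix.one_apply]

lemma trace_registerSwap_mul_kronecker (A B : Matrix (Fin d) (Fin d) ℂ) :
    (registerSwap d * (A ⊗ₖ B)).trace = (A * B).trace := by
  have h : ∀ x : Fin d × Fin d, (registerSwap d * (A ⊗ₖ B)) x x = A x.2 x.1 * B x.1 x.2 := fun x => by
    rw [registerSwap_mul_apply]; rfl
  simp only [Matrix.trace, Matrix.diag_apply, h, Matrix.mul_apply]
  rw [Fintype.sum_prod_type, Finset.sum_comm]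

lemma single_zero_eq : Matrix.single (0 : Fin 2) (0 : Fin 2) (1 : ℂ) = !![1, 0; 0, 0] := by
  ext i j; fin_cases i <;> fin_cases j <;> simp

lemma single_one_eq : Matrix.single (1 : Fin 2) (1 : Fin 2) (1 : ℂ) = !![0, 0; 0, 1] := by
  ext i j; fin_cases i <;> fin_cases j <;> simp

lemma controlledSwap_eq : controlledSwap d
    = Matrix.single 0 0 (1 : ℂ) ⊗ₖ (1 : Matrix (Fin d × Fin d) (Fin d × Fin d) ℂ)
      + Matrix.single 1 1 (1 : ℂ) ⊗ₖ registerSwap d := by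
  ext ⟨a, x⟩ ⟨b, y⟩
  fin_cases a <;> fin_cases b <;>
    simp [controlledSwap, registerSwap, Matrix.kroneckerMap_apply, Matrix.one_apply]

lemma hadamard_mul_single_mul_hadamard (b : Fin 2) :
    hadamard * Matrix.single b b (1 : ℂ) * hadamard
      = (1 / 2 : ℂ) • !![1, (rValue b : ℂ); (rValue b : ℂ), 1] := by
  have h : ((1 / Real.sqrt 2 : ℝ) : ℂ) * ((1 / Real.sqrt 2 : ℝ) : ℂ) = 1 / 2 := by
    rw [← Complex.ofReal_mul, div_mul_div_comm, Real.mul_self_sqrt (by norm_num)]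
    norm_num
  rw [hadamard, Matrix.smul_mul, Matrix.smul_mul, Matrix.mul_smul, smul_smul, h]
  congr 1
  fin_cases b
  · simp [single_zero_eq, rValue]
  · simp [single_one_eq, rValue]

/-- Conjugating the control projectors by Hadamard gates gives `|+⟩⟨+| ⊗ 1 + |-⟩⟨-| ⊗ SWAP`. -/
lemma swapCircuit_eq : swapCircuit d
    = ((1 / 2 : ℂ) • !![1, 1; 1, 1]) ⊗ₖ (1 : Matrix (Fin d × Fin d) (Fin d × Fin d) ℂ)
      + ((1 / 2 : ℂ) • !![1, -1; -1, 1]) ⊗ₖ registerSwap d := by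
  have h0 := hadamard_mul_single_mul_hadamard 0
  have h1 := hadamard_mul_single_mul_hadamard 1
  simp only [rValue, if_true, Fin.isValue, one_ne_zero, if_false, Complex.ofReal_one,
    Complex.ofReal_neg] at h0 h1
  rw [swapCircuit, controlledSwap_eq, mul_add, add_mul, ← Matrix.mul_kronecker_mul,
    ← Matrix.mul_kronecker_mul, ← Matrix.mul_kronecker_mul, ← Matrix.mul_kronecker_mul, h0, h1]
  simp

/-- Of the four terms of the conjugated state, the two diagonal ones have register trace `1`; the
two cross terms contain one SWAP and have trace `Tr(ρσ)`. -/
lemma swapProb_eq (ρ σ : DensityOperator d) (b : Fin 2) :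
    swapProb ρ σ b = (1 + rValue b * overlap ρ σ) / 2 := by
  have hc1 : ((1 / 2 : ℂ) • !![(1 : ℂ), 1; 1, 1])ᴴ = (1 / 2 : ℂ) • !![1, 1; 1, 1] := by
    ext i j; fin_cases i <;> fin_cases j <;> simp
  have hc2 : ((1 / 2 : ℂ) • !![(1 : ℂ), -1; -1, 1])ᴴ = (1 / 2 : ℂ) • !![1, -1; -1, 1] := by
    ext i j; fin_cases i <;> fin_cases j <;> simp
  have hX : (ρ.mat ⊗ₖ σ.mat).trace = 1 := by
    rw [Matrix.trace_kronecker, ρ.trace_eq_one, σ.trace_eq_one, one_mul]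
  have hS1 := trace_registerSwap_mul_kronecker ρ.mat σ.mat
  have hS2 : (ρ.mat ⊗ₖ σ.mat * registerSwap d).trace = (ρ.mat * σ.mat).trace := by
    rw [Matrix.trace_mul_comm, hS1]
  have hS3 : (registerSwap d * (ρ.mat ⊗ₖ σ.mat) * registerSwap d).trace = 1 := by
    rw [Matrix.trace_mul_comm, ← Matrix.mul_assoc, registerSwap_mul_self, Matrix.one_mul, hX]
  rw [swapProb, swapCircuit_eq, Matrix.conjTranspose_add, Matrix.conjTranspose_kronecker,
    Matrix.conjTranspose_kronecker, hc1, hc2, Matrix.conjTranspose_one,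
    registerSwap_conjTranspose]
  simp only [mul_add, add_mul, ← Matrix.mul_kronecker_mul, Matrix.trace_add, Matrix.trace_kronecker,
    Matrix.one_mul, Matrix.mul_one, hX, hS1, hS2, hS3]
  rw [overlap]
  generalize (ρ.mat * σ.mat).trace = τ
  fin_cases b
  · simp [single_zero_eq, Matrix.trace_fin_two, rValue]
    ring
  · simp [single_zero_eq, single_one_eq, Matrix.trace_fin_two, rValue]
    ring

end SwapTest

/-! ### Overlaps of depolarized pure states -/

section Overlap

variable {d : ℕ}

lemma PureState.dim_pos (v : PureState d) : 0 < d := by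
  rcases Nat.eq_zero_or_pos d with h | h
  · subst h
    have h1 := v.2
    rw [Subsingleton.elim v.1 0, norm_zero] at h1
    exact absurd h1 zero_ne_one
  · exact h

lemma fidelity_nonneg (v w : PureState d) : 0 ≤ fidelity v w := sq_nonneg _

lemma norm_inner_le_one (v w : PureState d) : ‖inner ℂ v.1 w.1‖ ≤ 1 := by
  have := norm_inner_le_norm (𝕜 := ℂ) v.1 w.1
  rwa [v.2, w.2, one_mul] at this

lemma fidelity_le_one (v w : PureState d) : fidelity v w ≤ 1 :=
  pow_le_one₀ (norm_nonneg _) (norm_inner_le_one v w)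

lemma fidelity_comm (v w : PureState d) : fidelity v w = fidelity w v := by
  rw [fidelity, fidelity, norm_inner_symm]

lemma fidelity_eq_one_of_dim_le_one (hd : d ≤ 1) (v w : PureState d) : fidelity v w = 1 := by
  obtain rfl : d = 1 := le_antisymm hd v.dim_pos
  have h : ∀ v : PureState 1, ‖v.1 0‖ ^ 2 = 1 := fun v => by
    have := EuclideanSpace.norm_sq_eq v.1
    rw [v.2] at this
    simpa using this.symm
  have h2 : inner ℂ v.1 w.1 = w.1 0 * star (v.1 0) := by
    simp [PiLp.inner_apply]
  rw [fidelity, h2, norm_mul, norm_star, mul_pow, h v, h w, one_mul]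

lemma trace_toDensity_mul (v w : PureState d) :
    (v.toDensity.mat * w.toDensity.mat).trace = (fidelity v w : ℂ) := by
  simp only [PureState.toDensity]
  have h1 : (star fun a => v.1 a) ⬝ᵥ (fun a => w.1 a) = inner ℂ v.1 w.1 := by
    rw [EuclideanSpace.inner_eq_star_dotProduct, dotProduct_comm]
  have h2 : (fun a => v.1 a) ⬝ᵥ (star fun a => w.1 a) = inner ℂ w.1 v.1 := rfl
  rw [Matrix.vecMulVec_mul_vecMulVec, Matrix.trace_vecMulVec, dotProduct_smul, h1, h2, smul_eq_mul,
    ← inner_conj_symm w.1 v.1, Complex.mul_conj', fidelity]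
  push_cast
  rfl

lemma overlap_depolarize (lam : ℝ) (h0 : 0 ≤ lam) (h1 : lam ≤ 1) (v w : PureState d) :
    overlap (depolarize lam h0 h1 v.toDensity) (depolarize lam h0 h1 w.toDensity)
      = (1 - lam) ^ 2 * fidelity v w + (2 * lam - lam ^ 2) / d := by
  have hd : (d : ℝ) ≠ 0 := by exact_mod_cast v.dim_pos.ne'
  have hd' : (d : ℂ) ≠ 0 := by exact_mod_cast v.dim_pos.ne'
  have key : ((depolarize lam h0 h1 v.toDensity).mat * (depolarize lam h0 h1 w.toDensity).mat).trace
      = (((1 - lam) ^ 2 * fidelity v w + (2 * lam - lam ^ 2) / d : ℝ) : ℂ) := by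
    simp only [depolarize, mul_add, add_mul, Matrix.smul_mul, Matrix.mul_smul, Matrix.trace_add,
      Matrix.trace_smul, Matrix.mul_one, Matrix.one_mul, trace_toDensity_mul,
      DensityOperator.trace_eq_one, Matrix.trace_one, Fintype.card_fin, smul_eq_mul]
    push_cast
    field_simp
    ring
  rw [overlap, key, Complex.ofReal_re]

lemma ballRadius_nonneg (v : PureState d) {lam : ℝ} (h0 : 0 ≤ lam) : 0 ≤ ballRadius d lam := by
  have h : (1 : ℝ) ≤ d := by exact_mod_cast v.dim_pos
  have h2 : 1 / (d : ℝ) ≤ 1 := by rw [div_le_one (by linarith)]; exact h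
  exact mul_nonneg (by linarith) h0

lemma ballRadius_le_one (d : ℕ) {lam : ℝ} (h0 : 0 ≤ lam) (h1 : lam ≤ 1) :
    ballRadius d lam ≤ 1 := by
  have h2 : 0 ≤ 1 / (d : ℝ) := by positivity
  rw [ballRadius]
  nlinarith

lemma overlap_depolarize_nonneg (lam : ℝ) (h0 : 0 ≤ lam) (h1 : lam ≤ 1) (v w : PureState d) :
    0 ≤ overlap (depolarize lam h0 h1 v.toDensity) (depolarize lam h0 h1 w.toDensity) := by
  rw [overlap_depolarize]
  have := fidelity_nonneg v w
  have h2 : 0 ≤ 2 * lam - lam ^ 2 := by nlinarith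
  positivity

lemma overlap_depolarize_le_one (lam : ℝ) (h0 : 0 ≤ lam) (h1 : lam ≤ 1) (v w : PureState d) :
    overlap (depolarize lam h0 h1 v.toDensity) (depolarize lam h0 h1 w.toDensity) ≤ 1 := by
  rw [overlap_depolarize]
  have hd : (1 : ℝ) ≤ d := by exact_mod_cast v.dim_pos
  have h2 : 0 ≤ 2 * lam - lam ^ 2 := by nlinarith
  have h3 := div_le_self h2 hd
  have h4 := mul_le_mul_of_nonneg_left (fidelity_le_one v w) (sq_nonneg (1 - lam))
  linarith

/-- Depolarizing changes overlaps by at most twice the ball radius. -/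
lemma abs_overlap_depolarize_sub_fidelity_le (lam : ℝ) (h0 : 0 ≤ lam) (h1 : lam ≤ 1)
    (v w : PureState d) :
    |overlap (depolarize lam h0 h1 v.toDensity) (depolarize lam h0 h1 w.toDensity)
      - fidelity v w| ≤ 2 * ballRadius d lam := by
  rw [overlap_depolarize]
  have hd : (1 : ℝ) ≤ d := by exact_mod_cast v.dim_pos
  have h2 : 0 ≤ 2 * lam - lam ^ 2 := by nlinarith
  have h3 : (1 - lam) ^ 2 * fidelity v w + (2 * lam - lam ^ 2) / d - fidelity v w
      = (2 * lam - lam ^ 2) * (1 / d - fidelity v w) := by ring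
  -- For `d ≥ 2` this uses `1/d ≤ 1 - 1/d`. For `d = 1` the right side is zero, but so is the left,
  -- since all fidelities are `1`.
  have h4 : |1 / (d : ℝ) - fidelity v w| ≤ 1 - 1 / d := by
    rcases le_or_gt d 1 with h | h
    · have : d = 1 := le_antisymm h v.dim_pos
      rw [fidelity_eq_one_of_dim_le_one h, this]
      norm_num
    · have h5 : (2 : ℝ) ≤ d := by exact_mod_cast h
      have h6 : 1 / (d : ℝ) ≤ 1 / 2 := one_div_le_one_div_of_le (by norm_num) h5
      have := fidelity_nonneg v w
      have := fidelity_le_one v w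
      rw [abs_le]
      constructor <;> linarith
  rw [h3, abs_mul, abs_of_nonneg h2, ballRadius]
  have h5 : 0 ≤ 1 - 1 / (d : ℝ) := (abs_nonneg _).trans h4
  calc _ ≤ (2 * lam - lam ^ 2) * (1 - 1 / d) := mul_le_mul_of_nonneg_left h4 h2
    _ ≤ (2 * lam) * (1 - 1 / d) := mul_le_mul_of_nonneg_right (by nlinarith) h5
    _ = _ := by ring

/-- Split `v` into its component along `c` and an orthogonal remainder of squared norm `1 - fidelity
v c`. This compares the moduli of the inner products; squaring costs a factor `2`, since both are at
most `1`. -/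
lemma fidelity_sub_le (v c w : PureState d) :
    fidelity v w - fidelity c w ≤ 2 * Real.sqrt (1 - fidelity v c) := by
  have hdec : v.1 = (inner ℂ c.1 v.1) • c.1 + (v.1 - (inner ℂ c.1 v.1) • c.1) := by abel
  set α := inner ℂ c.1 v.1 with hα
  have hn : ‖v.1 - α • c.1‖ ^ 2 = 1 - fidelity v c := by
    have h : inner ℂ v.1 (α • c.1) = ((fidelity v c : ℝ) : ℂ) := by
      rw [inner_smul_right, hα, ← inner_conj_symm c.1 v.1, Complex.conj_mul', fidelity]
      push_cast
      rfl
    have h' : RCLike.re ((fidelity v c : ℝ) : ℂ) = fidelity v c := Complex.ofReal_re _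
    rw [norm_sub_sq (𝕜 := ℂ), h, h', norm_smul, v.2, c.2, hα, norm_inner_symm, fidelity]
    ring
  have h1 : ‖inner ℂ v.1 w.1‖ ≤ ‖inner ℂ c.1 w.1‖ + Real.sqrt (1 - fidelity v c) := by
    rw [← hn, Real.sqrt_sq (norm_nonneg _)]
    conv_lhs => rw [hdec]
    rw [inner_add_left, inner_smul_left]
    refine (norm_add_le _ _).trans (add_le_add ?_ ?_)
    · rw [norm_mul, RCLike.norm_conj]
      exact mul_le_of_le_one_left (norm_nonneg _) (norm_inner_le_one c v)
    · have := norm_inner_le_norm (𝕜 := ℂ) (v.1 - α • c.1) w.1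
      rwa [w.2, mul_one] at this
  rw [fidelity, fidelity]
  have h2 := norm_inner_le_one v w
  have h3 := norm_inner_le_one c w
  have h4 := norm_nonneg (inner ℂ v.1 w.1)
  have h5 := norm_nonneg (inner ℂ c.1 w.1)
  have h6 := Real.sqrt_nonneg (1 - fidelity v c)
  nlinarith

lemma abs_fidelity_sub_le {v c : PureState d} (w : PureState d) {r : ℝ} (hv : v ∈ epsBall c r) :
    |fidelity v w - fidelity c w| ≤ 2 * Real.sqrt r := by
  have h := Real.sqrt_le_sqrt (show 1 - fidelity v c ≤ r from hv)
  have h1 := fidelity_sub_le v c w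
  have h2 := fidelity_sub_le c v w
  rw [fidelity_comm c v] at h2
  rw [abs_le]
  constructor <;> linarith

/-- Move `v` to `c`, then `w` to `e`, then depolarize: with `r` the ball radius this costs `2√r +
2√r + 2r`, and `r ≤ √r` because `r ≤ 1`. -/
lemma abs_overlap_depolarize_sub_le (lam : ℝ) (h0 : 0 ≤ lam) (h1 : lam ≤ 1)
    {v c w e : PureState d} (hv : v ∈ epsBall c (ballRadius d lam))
    (hw : w ∈ epsBall e (ballRadius d lam)) :
    |fidelity v w - overlap (depolarize lam h0 h1 c.toDensity) (depolarize lam h0 h1 e.toDensity)|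
      ≤ 8 * Real.sqrt (ballRadius d lam) := by
  have h2 := abs_fidelity_sub_le w hv
  have h3 := abs_fidelity_sub_le c hw
  rw [fidelity_comm w, fidelity_comm e] at h3
  have h4 := abs_overlap_depolarize_sub_fidelity_le lam h0 h1 c e
  have h5 : ballRadius d lam ≤ Real.sqrt (ballRadius d lam) :=
    Real.le_sqrt_of_sq_le (by
      have := ballRadius_nonneg v h0
      have := ballRadius_le_one d h0 h1
      nlinarith)
  have h6 := Real.sqrt_nonneg (ballRadius d lam)
  rw [abs_le] at h2 h3 h4 ⊢
  constructor <;> linarith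

lemma abs_pow_sub_pow_le {x y : ℝ} (hx0 : 0 ≤ x) (hx1 : x ≤ 1) (hy0 : 0 ≤ y) (hy1 : y ≤ 1)
    (k : ℕ) : |x ^ k - y ^ k| ≤ k * |x - y| := by
  induction k with
  | zero => simp
  | succ k ih =>
    have h : x ^ (k + 1) - y ^ (k + 1) = x * (x ^ k - y ^ k) + y ^ k * (x - y) := by ring
    rw [h]
    refine (abs_add_le _ _).trans ?_
    rw [abs_mul, abs_mul, abs_of_nonneg hx0, abs_of_nonneg (pow_nonneg hy0 k)]
    have h1 := mul_le_of_le_one_left (abs_nonneg (x ^ k - y ^ k)) hx1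
    have h2 := mul_le_of_le_one_left (abs_nonneg (x - y)) (pow_le_one₀ hy0 hy1 (n := k))
    push_cast
    linarith

end Overlap

/-! ### Ensembles of pure states in small balls -/

section PureEnsembles

variable {d : ℕ}

lemma continuous_fidelity : Continuous fun z : PureState d × PureState d => fidelity z.1 z.2 := by
  unfold fidelity
  fun_prop

lemma fidelity_pow_le_one (k : ℕ) (v w : PureState d) : fidelity v w ^ k ≤ 1 :=
  pow_le_one₀ (fidelity_nonneg v w) (fidelity_le_one v w)

lemma norm_fidelity_pow_le_one (k : ℕ) (v w : PureState d) : ‖fidelity v w ^ k‖ ≤ 1 := by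
  rw [Real.norm_of_nonneg (pow_nonneg (fidelity_nonneg v w) k)]
  exact fidelity_pow_le_one k v w

lemma integrable_fidelity_pow (k : ℕ) (v : PureState d) (ν : Measure (PureState d))
    [IsFiniteMeasure ν] : Integrable (fun w => fidelity v w ^ k) ν := by
  have h : Continuous fun w : PureState d => fidelity v w ^ k :=
    (continuous_fidelity.comp (Continuous.prodMk_right v)).pow k
  exact Integrable.of_bound h.aestronglyMeasurable 1
    (Filter.Eventually.of_forall fun w => norm_fidelity_pow_le_one k v w)

lemma integrable_integral_fidelity_pow (k : ℕ) (μ ν : Measure (PureState d))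
    [IsFiniteMeasure μ] [IsProbabilityMeasure ν] :
    Integrable (fun v => ∫ w, fidelity v w ^ k ∂ν) μ := by
  have h : StronglyMeasurable fun z : PureState d × PureState d => fidelity z.1 z.2 ^ k :=
    (continuous_fidelity.pow k).stronglyMeasurable
  refine Integrable.of_bound (h.integral_prod_right (ν := ν)).aestronglyMeasurable 1
    (Filter.Eventually.of_forall fun v => ?_)
  have := norm_integral_le_of_norm_le_const (μ := ν)
    (Filter.Eventually.of_forall fun w => norm_fidelity_pow_le_one k v w)
  simpa using this

lemma pureMeanFidelity_uniformMixture {N : ℕ} (k : ℕ) (μ ν : Fin N → Measure (PureState d))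
    [∀ i, IsProbabilityMeasure (μ i)] [∀ i, IsProbabilityMeasure (ν i)] :
    pureMeanFidelity k (uniformMixture μ) (uniformMixture ν)
      = ∑ i, ∑ j, (1 / N : ℝ) * (1 / N) * pureMeanFidelity k (μ i) (ν j) := by
  have h1 : ∀ v : PureState d, ∫ w, fidelity v w ^ k ∂(uniformMixture ν)
      = ∑ j, (1 / N : ℝ) * ∫ w, fidelity v w ^ k ∂(ν j) := fun v => by
    rw [uniformMixture, integral_smul_measure, integral_finsetSum_measure fun j _ =>
      integrable_fidelity_pow k v (ν j)]
    simp [Finset.mul_sum]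
  have h2 : ∀ i j, Integrable (fun v => (1 / N : ℝ) * ∫ w, fidelity v w ^ k ∂(ν j)) (μ i) :=
    fun i j => (integrable_integral_fidelity_pow k (μ i) (ν j)).const_mul _
  simp only [pureMeanFidelity, h1]
  rw [uniformMixture, integral_smul_measure, integral_finsetSum_measure fun i _ =>
    integrable_finsetSum _ fun j _ => h2 i j]
  simp only [ENNReal.toReal_inv, ENNReal.toReal_natCast, smul_eq_mul, Finset.mul_sum]
  refine Finset.sum_congr rfl fun i _ => ?_
  rw [integral_finsetSum _ fun j _ => h2 i j, Finset.mul_sum]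
  refine Finset.sum_congr rfl fun j _ => ?_
  rw [integral_const_mul]
  ring

lemma abs_integral_sub_le {α : Type*} [MeasurableSpace α] {μ : Measure α} [IsProbabilityMeasure μ]
    {f : α → ℝ} (hf : Integrable f μ) {c B : ℝ} (h : ∀ᵐ x ∂μ, |f x - c| ≤ B) :
    |∫ x, f x ∂μ - c| ≤ B := by
  have h1 : ∫ x, f x ∂μ - c = ∫ x, (f x - c) ∂μ := by
    rw [integral_sub hf (integrable_const c)]; simp
  rw [h1, ← Real.norm_eq_abs]
  have h2 := norm_integral_le_of_norm_le_const (μ := μ) (f := fun x => f x - c) (C := B) h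
  simpa using h2

lemma abs_pureMeanFidelity_sub_overlap_pow_le (k : ℕ) (lam : ℝ) (h0 : 0 ≤ lam) (h1 : lam ≤ 1)
    {c e : PureState d} {μ ν : Measure (PureState d)} [IsProbabilityMeasure μ]
    [IsProbabilityMeasure ν] (hμ : ∀ᵐ v ∂μ, v ∈ epsBall c (ballRadius d lam))
    (hν : ∀ᵐ v ∂ν, v ∈ epsBall e (ballRadius d lam)) :
    |pureMeanFidelity k μ ν
      - overlap (depolarize lam h0 h1 c.toDensity) (depolarize lam h0 h1 e.toDensity) ^ k|
      ≤ 8 * k * Real.sqrt (ballRadius d lam) := by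
  refine abs_integral_sub_le (integrable_integral_fidelity_pow k μ ν) ?_
  filter_upwards [hμ] with v hv
  refine abs_integral_sub_le (integrable_fidelity_pow k v ν) ?_
  filter_upwards [hν] with w hw
  refine (abs_pow_sub_pow_le (fidelity_nonneg v w) (fidelity_le_one v w)
    (overlap_depolarize_nonneg lam h0 h1 c e) (overlap_depolarize_le_one lam h0 h1 c e) k).trans ?_
  have := mul_le_mul_of_nonneg_left (abs_overlap_depolarize_sub_le lam h0 h1 hv hw)
    (Nat.cast_nonneg (α := ℝ) k)
  linarith

variable {N : ℕ} [NeZero N]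

lemma abs_pureMeanFidelity_sub_meanOverlap_le (k : ℕ) (lam : ℝ) (h0 : 0 ≤ lam) (h1 : lam ≤ 1)
    (ψ χ : Fin N → PureState d) {μ ν : Fin N → Measure (PureState d)}
    (hμ : ∀ x, IsBallRepresentation (ψ x) (ballRadius d lam)
      (depolarize lam h0 h1 (ψ x).toDensity) (μ x))
    (hν : ∀ x, IsBallRepresentation (χ x) (ballRadius d lam)
      (depolarize lam h0 h1 (χ x).toDensity) (ν x)) :
    |pureMeanFidelity k (uniformMixture μ) (uniformMixture ν)
      - meanOverlap k ((uniformPure ψ).depolarized lam h0 h1)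
          ((uniformPure χ).depolarized lam h0 h1)| ≤ 8 * k * Real.sqrt (ballRadius d lam) := by
  have : ∀ i, IsProbabilityMeasure (μ i) := fun i => (hμ i).1
  have : ∀ i, IsProbabilityMeasure (ν i) := fun i => (hν i).1
  have hN : (N : ℝ) ≠ 0 := by exact_mod_cast NeZero.ne N
  rw [pureMeanFidelity_uniformMixture, meanOverlap, ← Finset.sum_sub_distrib]
  simp only [← Finset.sum_sub_distrib, Ensemble.depolarized, uniformPure, ← mul_sub]
  refine (Finset.abs_sum_le_sum_abs _ _).trans ?_
  calc _ ≤ ∑ _i : Fin N, ∑ _j : Fin N, (1 / N : ℝ) * (1 / N) *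
        (8 * k * Real.sqrt (ballRadius d lam)) := by
        refine Finset.sum_le_sum fun i _ => (Finset.abs_sum_le_sum_abs _ _).trans ?_
        refine Finset.sum_le_sum fun j _ => ?_
        rw [abs_mul, abs_of_nonneg (by positivity : (0 : ℝ) ≤ 1 / N * (1 / N))]
        exact mul_le_mul_of_nonneg_left
          (abs_pureMeanFidelity_sub_overlap_pow_le k lam h0 h1 (hμ i).2.1 (hν j).2.1)
          (by positivity)
    _ = _ := by
        simp only [Finset.sum_const, Finset.card_univ, Fintype.card_fin, nsmul_eq_mul]
        field_simp

/-- The coefficients `1, 1, 2` of the three mean fidelities turn the error `8k√r` into `32k√r`. -/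
lemma abs_mmd_sub_pureMMD_le (k : ℕ) (lam : ℝ) (h0 : 0 ≤ lam) (h1 : lam ≤ 1)
    (ψ χ : Fin N → PureState d) {μ ν : Fin N → Measure (PureState d)}
    (hμ : ∀ x, IsBallRepresentation (ψ x) (ballRadius d lam)
      (depolarize lam h0 h1 (ψ x).toDensity) (μ x))
    (hν : ∀ x, IsBallRepresentation (χ x) (ballRadius d lam)
      (depolarize lam h0 h1 (χ x).toDensity) (ν x)) :
    |mmd k ((uniformPure ψ).depolarized lam h0 h1) ((uniformPure χ).depolarized lam h0 h1)
      - pureMMD k (uniformMixture μ) (uniformMixture ν)|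
        ≤ 32 * k * Real.sqrt (ballRadius d lam) := by
  have h2 := abs_pureMeanFidelity_sub_meanOverlap_le k lam h0 h1 ψ ψ hμ hμ
  have h3 := abs_pureMeanFidelity_sub_meanOverlap_le k lam h0 h1 χ χ hν hν
  have h4 := abs_pureMeanFidelity_sub_meanOverlap_le k lam h0 h1 ψ χ hμ hν
  rw [mmd, pureMMD]
  rw [abs_le] at h2 h3 h4 ⊢
  constructor <;> linarith

end PureEnsembles

/-! ### From the law of the data to weighted means -/

section Laws

variable {N d n : ℕ}

/-- The weight of one sample. -/
def sampleWeight (E E' : Ensemble N d) (z : Sample N) : ℝ :=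
  E.prob z.1.1 * E'.prob z.1.2 * swapProb (E.state z.1.1) (E'.state z.1.2) z.2

lemma sampleLaw_singleton (E E' : Ensemble N d) (z : Sample N) :
    sampleLaw E E' {z} = ENNReal.ofReal (sampleWeight E E' z) := by
  have h : sampleLaw E E' = ∑ y : Sample N, ENNReal.ofReal (sampleWeight E E' y) •
      Measure.dirac y := by
    rw [Fintype.sum_prod_type, Fintype.sum_prod_type]
    rfl
  rw [h, Measure.finsetSum_apply]
  simp only [Measure.smul_apply, smul_eq_mul]
  rw [Finset.sum_eq_single z]
  · simp
  · intro y _ hy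
    simp [hy]
  · simp

lemma sampleLaw_real_singleton {E E' : Ensemble N d} (h : ∀ z, 0 ≤ sampleWeight E E' z)
    (z : Sample N) : (sampleLaw E E').real {z} = sampleWeight E E' z := by
  rw [Measure.real, sampleLaw_singleton, ENNReal.toReal_ofReal (h z)]

lemma isProbabilityMeasure_sampleLaw {E E' : Ensemble N d} (h : ∀ z, 0 ≤ sampleWeight E E' z)
    (h1 : ∑ z, sampleWeight E E' z = 1) : IsProbabilityMeasure (sampleLaw E E') := by
  constructor
  rw [← Finset.coe_univ, ← sum_measure_singleton]
  simp only [sampleLaw_singleton]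
  rw [← ENNReal.ofReal_sum_of_nonneg fun z _ => h z, h1, ENNReal.ofReal_one]

lemma pi_sampleLaw_real {E E' : Ensemble N d} (h : ∀ z, 0 ≤ sampleWeight E E' z)
    [IsProbabilityMeasure (sampleLaw E E')] (A : (Fin n → Sample N) → Prop) :
    (Measure.pi fun _ : Fin n => sampleLaw E E').real {x | A x}
      = weightedProb (fun _ => sampleWeight E E') A := by
  classical
  have h1 : {x | A x} = ((Finset.univ.filter A : Finset (Fin n → Sample N)) : Set _) := by
    ext x; simp
  rw [h1, ← sum_measureReal_singleton, Finset.sum_filter, weightedProb, weightedMean]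
  refine Finset.sum_congr rfl fun x _ => ?_
  by_cases hx : A x
  · simp only [hx, if_true, mul_one]
    rw [Measure.real, Measure.pi_singleton, ENNReal.toReal_prod]
    exact Finset.prod_congr rfl fun i _ => sampleLaw_real_singleton h (x i)
  · simp [hx]

end Laws

/-! ### The estimator of MMD-`k` -/

section Estimator

variable {N d n : ℕ} {k : ℕ}

lemma abs_rValue_le_one (b : Fin 2) : |rValue b| ≤ 1 := by
  rw [rValue]; split_ifs <;> norm_num

lemma abs_fHat_le_one (k : ℕ) (x : Fin n → Sample N) : |fHat k x| ≤ 1 := by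
  have h : ∀ ℓ, |uStat k x ℓ| ≤ 1 := fun ℓ =>
    abs_uMean_le_one k (samplesAt x ℓ) (y := fun t => rValue (x t).2) fun t =>
      abs_rValue_le_one (x t).2
  rw [fHat, abs_mul, abs_of_nonneg (by positivity), one_div]
  have h1 : |∑ ℓ ∈ goodLabels k x, uStat k x ℓ| ≤ ((goodLabels k x).card : ℝ) := by
    refine (Finset.abs_sum_le_sum_abs _ _).trans ((Finset.sum_le_sum fun ℓ _ => h ℓ).trans ?_)
    simp
  exact (mul_le_mul_of_nonneg_left h1 (by positivity)).trans inv_mul_le_one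

/-- A pair of uniform ensembles all of whose overlaps are in `[0, 1]`. -/
structure IsUniformPair (E E' : Ensemble N d) : Prop where
  prob_left : ∀ i, E.prob i = 1 / N
  prob_right : ∀ i, E'.prob i = 1 / N
  overlap_nonneg : ∀ i j, 0 ≤ overlap (E.state i) (E'.state j)
  overlap_le_one : ∀ i j, overlap (E.state i) (E'.state j) ≤ 1

variable {E E' : Ensemble N d}

lemma IsUniformPair.swapProb_nonneg (h : IsUniformPair E E') (i j : Fin N) (b : Fin 2) :
    0 ≤ swapProb (E.state i) (E'.state j) b := by
  rw [swapProb_eq]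
  have h0 := h.overlap_nonneg i j
  have h1 := h.overlap_le_one i j
  rw [rValue]
  split_ifs <;> linarith

lemma sum_swapProb (ρ σ : DensityOperator d) : ∑ b, swapProb ρ σ b = 1 := by
  simp only [swapProb_eq, Fin.sum_univ_two, rValue, if_true, Fin.isValue, one_ne_zero, if_false]
  ring

lemma sum_swapProb_mul_rValue (ρ σ : DensityOperator d) :
    ∑ b, swapProb ρ σ b * rValue b = overlap ρ σ := by
  simp only [swapProb_eq, Fin.sum_univ_two, rValue, if_true, Fin.isValue, one_ne_zero, if_false]
  ring

lemma IsUniformPair.sampleWeight_eq (h : IsUniformPair E E') :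
    sampleWeight E E' = fun z => (Fintype.card (Fin N × Fin N) : ℝ)⁻¹ *
      swapProb (E.state z.1.1) (E'.state z.1.2) z.2 := by
  funext z
  rw [sampleWeight, h.prob_left, h.prob_right, Fintype.card_prod, Fintype.card_fin]
  push_cast
  rw [mul_inv, one_div]

lemma IsUniformPair.sampleWeight_nonneg (h : IsUniformPair E E') (z : Sample N) :
    0 ≤ sampleWeight E E' z := by
  rw [h.sampleWeight_eq]
  exact mul_nonneg (by positivity) (h.swapProb_nonneg _ _ _)

lemma IsUniformPair.isProbabilityMeasure [NeZero N] (h : IsUniformPair E E') :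
    IsProbabilityMeasure (sampleLaw E E') := by
  refine isProbabilityMeasure_sampleLaw h.sampleWeight_nonneg ?_
  rw [h.sampleWeight_eq, Fintype.sum_prod_type]
  simp only [← Finset.mul_sum, sum_swapProb, mul_one]
  exact sum_card_inv

lemma IsUniformPair.meanOverlap_eq (h : IsUniformPair E E') (k : ℕ) :
    meanOverlap k E E' = (Fintype.card (Fin N × Fin N) : ℝ)⁻¹ *
      ∑ ℓ : Fin N × Fin N, overlap (E.state ℓ.1) (E'.state ℓ.2) ^ k := by
  rw [meanOverlap, Fintype.sum_prod_type, Finset.mul_sum]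
  simp only [h.prob_left, h.prob_right, Finset.mul_sum, Fintype.card_prod, Fintype.card_fin]
  push_cast
  simp only [mul_inv, one_div]

lemma IsUniformPair.meanOverlap_mem [NeZero N] (h : IsUniformPair E E') (k : ℕ) :
    0 ≤ meanOverlap k E E' ∧ meanOverlap k E E' ≤ 1 := by
  rw [h.meanOverlap_eq]
  have hQ : (0 : ℝ) < Fintype.card (Fin N × Fin N) := by exact_mod_cast Fintype.card_pos
  refine ⟨mul_nonneg (by positivity) (Finset.sum_nonneg fun ℓ _ =>
    pow_nonneg (h.overlap_nonneg _ _) k), ?_⟩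
  rw [inv_mul_le_one₀ hQ]
  refine (Finset.sum_le_sum fun ℓ _ =>
    pow_le_one₀ (h.overlap_nonneg ℓ.1 ℓ.2) (h.overlap_le_one ℓ.1 ℓ.2)).trans ?_
  simp

lemma IsUniformPair.fHat_real_eq [NeZero N] (h : IsUniformPair E E') (k n : ℕ) (t : ℝ) :
    (Measure.pi fun _ : Fin n => sampleLaw E E').real
        {x | 2 * t < |fHat k x - meanOverlap k E E'|}
      = weightedProb (fun _ z => (Fintype.card (Fin N × Fin N) : ℝ)⁻¹ *
          swapProb (E.state z.1.1) (E'.state z.1.2) z.2) (fun x : Fin n → Sample N =>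
        2 * t < |meanUMean k (fun i => (x i).1) (fun i => rValue (x i).2)
          - (Fintype.card (Fin N × Fin N) : ℝ)⁻¹ *
            ∑ ℓ : Fin N × Fin N, overlap (E.state ℓ.1) (E'.state ℓ.2) ^ k|) := by
  have := h.isProbabilityMeasure
  rw [pi_sampleLaw_real h.sampleWeight_nonneg, h.sampleWeight_eq, h.meanOverlap_eq]
  rfl

/-- A sample size `n` with which each of the three means is estimated within `2 * t`, except with
probability `δ / 3`, suffices to estimate MMD-`k` within `8 * t`. -/
lemma estimatesWith_of_tails [NeZero N] {E₁ E₂ : Ensemble N d} (h11 : IsUniformPair E₁ E₁)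
    (h22 : IsUniformPair E₂ E₂) (h12 : IsUniformPair E₁ E₂) {M : ℕ} {t δ ε D : ℝ}
    (hD : |mmd k E₁ E₂ - D| + 8 * t ≤ ε)
    (h : ∀ E E' : Ensemble N d, IsUniformPair E E' →
      (Measure.pi fun _ : Fin (M / 3) => sampleLaw E E').real
        {x | 2 * t < |fHat k x - meanOverlap k E E'|} ≤ δ / 3) :
    EstimatesWith k M E₁ E₂ D ε δ := by
  have := h11.isProbabilityMeasure
  have := h22.isProbabilityMeasure
  have := h12.isProbabilityMeasure
  set n := M / 3
  set P₁ := Measure.pi fun _ : Fin n => sampleLaw E₁ E₁ with hP₁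
  set P₂ := Measure.pi fun _ : Fin n => sampleLaw E₂ E₂ with hP₂
  set P₃ := Measure.pi fun _ : Fin n => sampleLaw E₁ E₂ with hP₃
  have hPP : dataLaw n E₁ E₂ = P₁.prod (P₂.prod P₃) := rfl
  set B₁ : Set (Fin n → Sample N) := {x | 2 * t < |fHat k x - meanOverlap k E₁ E₁|} with hB₁
  set B₂ : Set (Fin n → Sample N) := {x | 2 * t < |fHat k x - meanOverlap k E₂ E₂|} with hB₂
  set B₃ : Set (Fin n → Sample N) := {x | 2 * t < |fHat k x - meanOverlap k E₁ E₂|} with hB₃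
  have hm : ∀ S : Set (Fin n → Sample N), MeasurableSet S := fun S => S.toFinite.measurableSet
  have hq1 : (P₁.prod (P₂.prod P₃)).real (Prod.fst ⁻¹' B₁) = P₁.real B₁ :=
    (measurePreserving_fst (μ := P₁) (ν := P₂.prod P₃)).measureReal_preimage
      (hm B₁).nullMeasurableSet
  have hq2 : (P₁.prod (P₂.prod P₃)).real ((fun x => x.2.1) ⁻¹' B₂) = P₂.real B₂ :=
    ((measurePreserving_fst (μ := P₂) (ν := P₃)).comp
      (measurePreserving_snd (μ := P₁) (ν := P₂.prod P₃))).measureReal_preimage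
      (hm B₂).nullMeasurableSet
  have hq3 : (P₁.prod (P₂.prod P₃)).real ((fun x => x.2.2) ⁻¹' B₃) = P₃.real B₃ :=
    ((measurePreserving_snd (μ := P₂) (ν := P₃)).comp
      (measurePreserving_snd (μ := P₁) (ν := P₂.prod P₃))).measureReal_preimage
      (hm B₃).nullMeasurableSet
  -- Failure forces one of the three means to be off by more than `2 * t`. The union bound over the
  -- three data sets uses only their marginal laws.
  have hsub : {x : Data N n | |mmdHat k x - D| ≤ ε}ᶜ
      ⊆ (Prod.fst ⁻¹' B₁) ∪ (((fun x => x.2.1) ⁻¹' B₂) ∪ ((fun x => x.2.2) ⁻¹' B₃)) := by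
    intro x hx
    by_contra hcon
    simp only [Set.mem_union, Set.mem_preimage, hB₁, hB₂, hB₃, Set.mem_ofPred_eq, not_or,
      not_lt] at hcon
    obtain ⟨h1, h2, h3⟩ := hcon
    refine hx ?_
    rw [Set.mem_ofPred_eq]
    refine le_trans ?_ hD
    have h4 : |mmdHat k x - mmd k E₁ E₂| ≤ 8 * t := by
      rw [mmdHat, mmd]
      rw [abs_le] at h1 h2 h3 ⊢
      constructor <;> linarith
    have h5 := abs_sub_le (mmdHat k x) (mmd k E₁ E₂) D
    linarith
  have hmD : MeasurableSet {x : Data N n | |mmdHat k x - D| ≤ ε} := (Set.toFinite _).measurableSet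
  have : IsProbabilityMeasure (dataLaw n E₁ E₂) := by rw [hPP]; infer_instance
  have hcompl := probReal_compl_eq_one_sub (μ := dataLaw n E₁ E₂) hmD
  rw [EstimatesWith]
  have hle : (dataLaw n E₁ E₂).real {x : Data N n | |mmdHat k x - D| ≤ ε}ᶜ ≤ δ := by
    rw [hPP]
    refine (measureReal_mono hsub).trans ((measureReal_union_le _ _).trans ?_)
    have h6 := measureReal_union_le (μ := P₁.prod (P₂.prod P₃))
      ((fun x => x.2.1) ⁻¹' B₂) ((fun x => x.2.2) ⁻¹' B₃)
    have h7 := h E₁ E₁ h11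
    have h8 := h E₂ E₂ h22
    have h9 := h E₁ E₂ h12
    linarith
  linarith

variable [NeZero N]

lemma isUniformPair_depolarized (ψ χ : Fin N → PureState d) (lam : ℝ) (h0 : 0 ≤ lam)
    (h1 : lam ≤ 1) : IsUniformPair ((uniformPure ψ).depolarized lam h0 h1)
      ((uniformPure χ).depolarized lam h0 h1) where
  prob_left _ := rfl
  prob_right _ := rfl
  overlap_nonneg i j := overlap_depolarize_nonneg lam h0 h1 (ψ i) (χ j)
  overlap_le_one i j := overlap_depolarize_le_one lam h0 h1 (ψ i) (χ j)

lemma rpow_div_sq_mul_sq {H : ℝ} (hH : 0 ≤ H) (k : ℕ) :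
    (H / (N : ℝ) ^ 2) ^ (1 / (k : ℝ)) * (N : ℝ) ^ 2
      = H ^ (1 / (k : ℝ)) * (N : ℝ) ^ (2 - 2 / (k : ℝ)) := by
  have hN : (0 : ℝ) < N := by exact_mod_cast NeZero.pos N
  rw [Real.div_rpow hH (by positivity), Real.rpow_sub hN, ← Real.rpow_natCast, ← Real.rpow_mul hN.le]
  push_cast
  rw [Real.rpow_two, mul_one_div]
  ring

end Estimator

end QEns

end

/-! ### The main theorem: choice of the sample size -/

theorem mainTheorem9 (δ₀ : ℝ) (hδ₀ : δ₀ < 1) :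
    ∃ C : ℝ, 0 < C ∧
      ∀ (k N d : ℕ) [NeZero N] (ψ χ : Fin N → QEns.PureState d)
        (lam : ℝ) (h0 : 0 ≤ lam) (h1 : lam ≤ 1) (ε δ : ℝ),
        1 ≤ k → 0 < δ → δ ≤ δ₀ →
        32 * k * Real.sqrt (QEns.ballRadius d lam) < ε →
        (k ! : ℝ) / (ε - 32 * k * Real.sqrt (QEns.ballRadius d lam)) ^ 2 * Real.log (1 / δ)
            ≤ (N : ℝ) ^ 2 →
        ∃ M₀ : ℕ,
          (M₀ : ℝ) ≤ C *
            (((k ! : ℝ) / (ε - 32 * k * Real.sqrt (QEns.ballRadius d lam)) ^ 2 *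
                Real.log (1 / δ)) ^ (1 / (k : ℝ)) * (N : ℝ) ^ (2 - 2 / (k : ℝ))) ∧
          ∀ M : ℕ, M₀ ≤ M →
            -- the target is MMD-`k` of the two ensembles of mixed output states
            QEns.EstimatesWith k M
              ((QEns.uniformPure ψ).depolarized lam h0 h1)
              ((QEns.uniformPure χ).depolarized lam h0 h1)
              (QEns.mmd k ((QEns.uniformPure ψ).depolarized lam h0 h1)
                ((QEns.uniformPure χ).depolarized lam h0 h1)) ε δ ∧
            -- the target is MMD-`k` of two ensembles of pure states that represent the outputs
            ∀ μ ν : Fin N → Measure (QEns.PureState d),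
              (∀ x, QEns.IsBallRepresentation (ψ x) (QEns.ballRadius d lam)
                (QEns.depolarize lam h0 h1 (ψ x).toDensity) (μ x)) →
              (∀ x, QEns.IsBallRepresentation (χ x) (QEns.ballRadius d lam)
                (QEns.depolarize lam h0 h1 (χ x).toDensity) (ν x)) →
              QEns.EstimatesWith k M
                ((QEns.uniformPure ψ).depolarized lam h0 h1)
                ((QEns.uniformPure χ).depolarized lam h0 h1)
                (QEns.pureMMD k (QEns.uniformMixture μ) (QEns.uniformMixture ν)) ε δ := by
  rcases le_or_gt δ₀ 0 with hneg | hpos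
  · exact ⟨1, one_pos, fun k N d _ ψ χ lam h0 h1 ε δ _ hδ hδ' =>
      absurd (hδ.trans_le hδ') (not_lt.mpr hneg)⟩
  have hL₀ : 0 < Real.log (1 / δ₀) := Real.log_pos (by rw [lt_div_iff₀ hpos]; linarith)
  obtain ⟨C, hC, hmain⟩ := QEns.exists_sample_complexity hL₀
  set L₀ := Real.log (1 / δ₀) with hL₀def
  -- The factor `3` pays for splitting the samples among three pairs; the term `256 / L₀` absorbs
  -- the rounding in `M₀`.
  refine ⟨3 * C + 256 / L₀, by positivity, ?_⟩
  intro k N d _ ψ χ lam h0 h1 ε δ hk hδ hδ' hε hN2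
  set slack := 32 * k * Real.sqrt (QEns.ballRadius d lam) with hslack
  have hslack0 : 0 ≤ slack := by positivity
  set L := Real.log (1 / δ) with hLdef
  have hL : L₀ ≤ L := Real.log_le_log (by positivity) (one_div_le_one_div_of_le hδ hδ')
  have hL0 : 0 < L := hL₀.trans_le hL
  have hexp : Real.exp (-L) = δ := by
    rw [hLdef, one_div, Real.log_inv, neg_neg, Real.exp_log hδ]
  obtain ⟨t, ht⟩ : ∃ t, ε - slack = 8 * t := ⟨(ε - slack) / 8, by ring⟩
  have ht0 : 0 < t := by linarith
  have hN : (0 : ℝ) < N := by exact_mod_cast NeZero.pos N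
  rw [ht] at hN2 ⊢
  set H := (k ! : ℝ) / (8 * t) ^ 2 * L with hH
  have hH0 : 0 < H := by positivity
  -- the tail bound for a single pair gives both claims
  have hfinish : ∀ M : ℕ, (∀ E E' : QEns.Ensemble N d, QEns.IsUniformPair E E' →
      (Measure.pi fun _ : Fin (M / 3) => QEns.sampleLaw E E').real
        {x | 2 * t < |QEns.fHat k x - QEns.meanOverlap k E E'|} ≤ δ / 3) →
      QEns.EstimatesWith k M
        ((QEns.uniformPure ψ).depolarized lam h0 h1)
        ((QEns.uniformPure χ).depolarized lam h0 h1)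
        (QEns.mmd k ((QEns.uniformPure ψ).depolarized lam h0 h1)
          ((QEns.uniformPure χ).depolarized lam h0 h1)) ε δ ∧
      ∀ μ ν : Fin N → Measure (QEns.PureState d),
        (∀ x, QEns.IsBallRepresentation (ψ x) (QEns.ballRadius d lam)
          (QEns.depolarize lam h0 h1 (ψ x).toDensity) (μ x)) →
        (∀ x, QEns.IsBallRepresentation (χ x) (QEns.ballRadius d lam)
          (QEns.depolarize lam h0 h1 (χ x).toDensity) (ν x)) →
        QEns.EstimatesWith k M
          ((QEns.uniformPure ψ).depolarized lam h0 h1)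
          ((QEns.uniformPure χ).depolarized lam h0 h1)
          (QEns.pureMMD k (QEns.uniformMixture μ) (QEns.uniformMixture ν)) ε δ := by
    intro M hM
    have h11 := QEns.isUniformPair_depolarized ψ ψ lam h0 h1
    have h22 := QEns.isUniformPair_depolarized χ χ lam h0 h1
    have h12 := QEns.isUniformPair_depolarized ψ χ lam h0 h1
    refine ⟨QEns.estimatesWith_of_tails h11 h22 h12 (t := t) ?_ hM, fun μ ν hμ hν =>
      QEns.estimatesWith_of_tails h11 h22 h12 (t := t) ?_ hM⟩
    · rw [sub_self, abs_zero]; linarith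
    · have := QEns.abs_mmd_sub_pureMMD_le k lam h0 h1 ψ χ hμ hν
      linarith
  -- For `t > 1` no samples are needed: estimates in `[-1, 1]` of a mean in `[0, 1]` err by at most
  -- `2 < 2t`.
  rcases lt_or_ge 1 t with ht1 | ht1
  · refine ⟨0, by rw [Nat.cast_zero]; positivity, fun M _ => hfinish M fun E E' h => ?_⟩
    have hempty : {x : Fin (M / 3) → QEns.Sample N |
        2 * t < |QEns.fHat k x - QEns.meanOverlap k E E'|} = ∅ := by
      refine Set.eq_empty_of_forall_notMem fun x hx => ?_
      rw [Set.mem_ofPred_eq] at hx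
      have h2 := abs_le.mp (QEns.abs_fHat_le_one k x)
      have h3 := h.meanOverlap_mem k
      have h4 : |QEns.fHat k x - QEns.meanOverlap k E E'| ≤ 2 := by
        rw [abs_le]; constructor <;> linarith
      linarith
    rw [hempty, measureReal_empty]
    positivity
  -- With this `a`, the product `a * N²` is exactly the claimed rate, and the lower bound assumed on
  -- `N²` says that `a ≤ 1`.
  · set a := (H / (N : ℝ) ^ 2) ^ (1 / (k : ℝ)) with ha
    have hHN : H / (N : ℝ) ^ 2 ≤ 1 := by rw [div_le_one (by positivity)]; exact hN2
    have ha0 : 0 ≤ a := by positivity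
    have ha1 : a ≤ 1 := Real.rpow_le_one (by positivity) hHN (by positivity)
    have hak : a ^ k = H / (N : ℝ) ^ 2 := by
      rw [ha, one_div]
      exact Real.rpow_inv_natCast_pow (by positivity) (by omega)
    have haN : H ≤ a * (N : ℝ) ^ 2 := by
      have h2 : a ^ k ≤ a := pow_le_of_le_one ha0 ha1 (by omega)
      rwa [hak, div_le_iff₀ (by positivity)] at h2
    have hL64 : L₀ ≤ 64 * H := by
      have h2 : 64 * H = k ! * L / t ^ 2 := by
        rw [hH]; field_simp; ring
      have h3 : (1 : ℝ) ≤ k ! := by exact_mod_cast Nat.factorial_pos k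
      rw [h2, le_div_iff₀ (by positivity)]
      have h4 : t ^ 2 ≤ 1 := pow_le_one₀ ht0.le ht1
      have h5 := mul_le_mul_of_nonneg_left h4 hL₀.le
      have h6 := le_mul_of_one_le_left hL0.le h3
      linarith
    -- The summand `3` covers the loss of at most `2` in `3 * (M / 3)`. Together with the ceiling
    -- the overhead is at most `4`, which is at most `256 / L₀ * (a * N²)` because `L₀ ≤ 64 * H ≤ 64
    -- * a * N²`.
    refine ⟨⌈3 * C * (a * (N : ℝ) ^ 2)⌉₊ + 3, ?_, fun M hM => hfinish M fun E E' h => ?_⟩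
    · rw [← QEns.rpow_div_sq_mul_sq hH0.le k, ← ha]
      have h2 := (Nat.ceil_lt_add_one
        (by positivity : 0 ≤ 3 * C * (a * (N : ℝ) ^ 2))).le
      have h3 : 4 ≤ 256 / L₀ * (a * (N : ℝ) ^ 2) := by
        rw [div_mul_eq_mul_div, le_div_iff₀ hL₀]
        linarith
      push_cast
      linarith
    · rw [h.fHat_real_eq, ← hexp]
      refine hmain (Λ := Fin N × Fin N) (β := Fin 2) (n := M / 3) (k := k)
        (v := fun ℓ b => QEns.swapProb (E.state ℓ.1) (E'.state ℓ.2) b) (R := QEns.rValue)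
        (μ := fun ℓ => QEns.overlap (E.state ℓ.1) (E'.state ℓ.2)) (t := t) (a := a) (L := L)
        (fun _ => h.swapProb_nonneg _ _) (fun _ => QEns.sum_swapProb _ _)
        QEns.abs_rValue_le_one (fun _ => QEns.sum_swapProb_mul_rValue _ _)
        (fun _ => h.overlap_nonneg _ _) (fun _ => h.overlap_le_one _ _) hk ht0 ht1 hL ha0 ha1 ?_ ?_
      · rw [hak, hH, Fintype.card_prod, Fintype.card_fin]
        push_cast
        field_simp
        ring
      · have h2 : 3 * C * (a * (N : ℝ) ^ 2) + 3 ≤ M := by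
          have h3 : ((⌈3 * C * (a * (N : ℝ) ^ 2)⌉₊ + 3 : ℕ) : ℝ) ≤ M := by exact_mod_cast hM
          push_cast at h3
          linarith [Nat.le_ceil (3 * C * (a * (N : ℝ) ^ 2))]
        have h3 : (M : ℝ) ≤ 3 * ((M / 3 : ℕ) : ℝ) + 2 := by
          have : M ≤ 3 * (M / 3) + 2 := by omega
          exact_mod_cast this
        rw [Fintype.card_prod, Fintype.card_fin]
        push_cast
        linarith
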